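/- Let $S_1,S_2$ be two independent discrete memoryless sources with finite alphabets $\mathcal S_1,\mathcal S_2$ and per-letter entropies $H(S_1),H(S_2)$ (all logarithms to one fixed base), and write $S_k^n=(S_k[1],\ldots,S_k[n])$. In the $(3,1)$ secure symmetrical multilevel diversity coding (S-SMDC) problem, a code of block length $n$ consists of a random key $K$, independent of the sources and with an unrestricted key space $\mathcal K$, encoders $e_l:\mathcal S_1^n\times\mathcal S_2^n\times\mathcal K\to\{1,\ldots,M_l\}$ with outputs $X_l=e_l(S_1^n,S_2^n,K)$, $l=1,2,3$, and decoders $d_U$ for $U\subseteq\{1,2,3\}$, $|U|\ge 2$, which map $X_U=(X_l)_{l\in U}$ to an estimate of $(S_1^n,\ldots,S_{|U|-1}^n)$ and do not have access to the key. A nonnegative triple $(R_1,R_2,R_3)$ is admissible if for every $\epsilon>0$ and all sufficiently large $n$ there is such a code with $\frac1n\log M_l\le R_l+\epsilon$ for all $l$, $\Pr\{d_U(X_U)\ne(S_1^n,\ldots,S_{|U|-1}^n)\}\le\epsilon$ for all $U$ with $|U|\ge2$, and $H(S_1^n,S_2^n\mid X_A)=H(S_1^n,S_2^n)$ for all $A\subseteq\{1,2,3\}$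 with $|A|\le1$. The admissible rate region is the set of all admissible triples. In the single-level $(3,1,m)$ problem with one source $S$, the code encodes $S^n$ with a key, the decoders $d_U$ have to reproduce $S^n$ with error probability at most $\epsilon$ whenever $|U|\ge m$, and $H(S^n\mid X_A)=H(S^n)$ is required whenever $|A|\le1$; admissibility is defined in the same way. Superposition coding for the $(3,1)$ S-SMDC problem encodes $S_1$ and $S_2$ separately, with independent keys, by codes for the $(3,1,2)$ and the $(3,1,3)$ single-level problem; encoder $l$ outputs the pair $X_l=(X_l^{(1)},X_l^{(2)})$ of the two coded messages, and each source is decoded from its own components. **Theorem.** The admissible rate region of the $(3,1)$ S-SMDC problem is the set of all triples $(R_1,R_2,R_3)$ with $$R_1\ge H(S_1),\quad R_2\ge H(S_1),\quad R_3\ge H(S_1),$$ $$R_1+R_2\ge 2H(S_1)+H(S_2),\quad R_2+R_3\ge 2H(S_1)+H(S_2),\quad R_3+R_1\ge 2H(S_1)+H(S_2).$$ Superposition coding achieves this entire region: the triples for which the codes in the definition of admissibility can be taken to be superposition codes are exactly the admissible triples, and the admissible triples are exactly the sums $(R_l^{(1)}+R_l^{(2)})_{l=1,2,3}$, where $(R_l^{(1)})_l$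 is admissible for the $(3,1,2)$ single-level problem with source $S_1$ and $(R_l^{(2)})_l$ is admissible for the $(3,1,3)$ single-level problem with source $S_2$. -/

import Mathlib

open MeasureTheory Filter

universe u

noncomputable section

namespace SecureDiversityCoding

/-- Shannon entropy `H(X)` (natural logarithm) of a random variable `X` with finitely many
values, under the probability measure `μ`. -/
def entropy {Ω β : Type*} [MeasurableSpace Ω] [Fintype β] (μ : Measure Ω) (X : Ω → β) : ℝ :=
  ∑ b, Real.negMulLog (μ.real (X ⁻¹' {b}))

/-- Conditional Shannon entropy `H(X | Y) = ∑ y, P(Y = y) H(X | Y = y)` of finitely valued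
random variables. -/
def condEntropy {Ω β γ : Type*} [MeasurableSpace Ω] [Fintype β] [Fintype γ]
    (μ : Measure Ω) (X : Ω → β) (Y : Ω → γ) : ℝ :=
  ∑ y, μ.real (Y ⁻¹' {y}) * entropy (ProbabilityTheory.cond μ (Y ⁻¹' {y})) X

/-- Entropy `H(S)` per letter of a discrete memoryless source with letter distribution `μ`. -/
def sourceEntropy {α : Type*} [MeasurableSpace α] [Fintype α] (μ : Measure α) : ℝ :=
  entropy μ (id : α → α)

/-! ### Secure symmetrical single-level diversity coding -/

/-- An `(n, (M_1, …, M_L))` code for the `(L, N, m)` single-level problem with source alphabet `α`: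
a key space with a key distribution (without any restriction on its size), encoding functions
`e_l : α^n × K → {1, …, M_l}`, and decoding functions `d_U` for all `U` with `|U| ≥ m`. -/
structure SSDCCode (L m n : ℕ) (α : Type u) [MeasurableSpace α] where
  M : Fin L → ℕ
  Key : Type
  [keySpace : MeasurableSpace Key]
  keyLaw : Measure Key
  [keyProb : IsProbabilityMeasure keyLaw]
  enc : ∀ l : Fin L, (Fin n → α) × Key → Fin (M l)
  measurable_enc : ∀ l, Measurable (enc l)
  dec : ∀ U : Finset (Fin L), m ≤ U.card → (∀ l : U, Fin (M l)) → (Fin n → α)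

attribute [instance] SSDCCode.keySpace SSDCCode.keyProb

namespace SSDCCode

variable {L m n : ℕ} {α : Type u} [MeasurableSpace α]

/-- The joint law of `(S^n, K)`: the letters of `S^n` are i.i.d. with law `μ`, and the key `K` is
independent of the source. -/
def law (c : SSDCCode L m n α) (μ : Measure α) : Measure ((Fin n → α) × c.Key) :=
  (Measure.pi fun _ : Fin n => μ).prod c.keyLaw

/-- The encoder outputs `X_U = (X_l)_{l ∈ U}`. -/
def output (c : SSDCCode L m n α) (U : Finset (Fin L)) (ω : (Fin n → α) × c.Key) :
    ∀ l : U, Fin (c.M l) :=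
  fun l => c.enc l ω

/-- Rate constraints `(1/n) log M_l ≤ R_l + ε`. -/
def RateConstraint (c : SSDCCode L m n α) (R : Fin L → ℝ) (ε : ℝ) : Prop :=
  ∀ l, (1 / (n : ℝ)) * Real.log (c.M l) ≤ R l + ε

/-- `Pr{d_U(X_U) ≠ S^n} ≤ ε` whenever `|U| ≥ m`. -/
def Reconstruction (c : SSDCCode L m n α) (μ : Measure α) (ε : ℝ) : Prop :=
  ∀ (U : Finset (Fin L)) (hU : m ≤ U.card),
    (c.law μ).real {ω | c.dec U hU (c.output U ω) ≠ ω.1} ≤ ε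

/-- `H(S^n | X_A) = H(S^n)` whenever `|A| ≤ N`. -/
def PerfectSecrecy [Fintype α] (c : SSDCCode L m n α) (N : ℕ) (μ : Measure α) : Prop :=
  ∀ A : Finset (Fin L), A.card ≤ N →
    condEntropy (c.law μ) Prod.fst (c.output A) = entropy (c.law μ) Prod.fst

end SSDCCode

/-- The admissible rate region of the `(L, N, m)` single-level problem with letter
distribution `μ`. -/
def ssdcRegion (L N m : ℕ) {α : Type u} [Fintype α] [MeasurableSpace α] (μ : Measure α) :
    Set (Fin L → ℝ) :=
  {R | (∀ l, 0 ≤ R l) ∧ ∀ ε : ℝ, 0 < ε → ∀ᶠ n : ℕ in atTop, ∃ c : SSDCCode L m n α,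
    c.RateConstraint R ε ∧ c.Reconstruction μ ε ∧ c.PerfectSecrecy N μ}

/-! ### Secure symmetrical multilevel diversity coding

The `(L, N)` problem has `J = L - N` independent sources. They are indexed by `k : Fin J`,
starting at `0`, so that the source with index `k` is the one usually called `S_{k+1}`: it has to be
recovered from every `U` with `|U| ≥ N + k + 1`. -/

/-- An `(n, (M_1, …, M_L))` code for the `(L, N)` multilevel problem: a key space with a key
distribution, encoding functions of all sources and the key, and, for all `U` with `|U| ≥ N + 1`,
a decoding function `d_U` that outputs the first `|U| - N` sources. -/
structure SMDCCode (L N n : ℕ) {J : ℕ} (α : Fin J → Type u) [∀ k, MeasurableSpace (α k)] where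
  M : Fin L → ℕ
  Key : Type
  [keySpace : MeasurableSpace Key]
  keyLaw : Measure Key
  [keyProb : IsProbabilityMeasure keyLaw]
  enc : ∀ l : Fin L, (∀ k, Fin n → α k) × Key → Fin (M l)
  measurable_enc : ∀ l, Measurable (enc l)
  dec : ∀ U : Finset (Fin L), N + 1 ≤ U.card → (∀ l : U, Fin (M l)) →
    ∀ k : {k : Fin J // N + (k : ℕ) + 1 ≤ U.card}, Fin n → α k

attribute [instance] SMDCCode.keySpace SMDCCode.keyProb

namespace SMDCCode

variable {L N n J : ℕ} {α : Fin J → Type u} [∀ k, MeasurableSpace (α k)]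

/-- The joint law of all source blocks and the key: the sources are independent and memoryless,
and the key is independent of them. -/
def law (c : SMDCCode L N n α) (μ : ∀ k, Measure (α k)) :
    Measure ((∀ k, Fin n → α k) × c.Key) :=
  (Measure.pi fun k => Measure.pi fun _ : Fin n => μ k).prod c.keyLaw

/-- The encoder outputs `X_U = (X_l)_{l ∈ U}`. -/
def output (c : SMDCCode L N n α) (U : Finset (Fin L)) (ω : (∀ k, Fin n → α k) × c.Key) :
    ∀ l : U, Fin (c.M l) :=
  fun l => c.enc l ω

/-- Rate constraints `(1/n) log M_l ≤ R_l + ε`. -/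
def RateConstraint (c : SMDCCode L N n α) (R : Fin L → ℝ) (ε : ℝ) : Prop :=
  ∀ l, (1 / (n : ℝ)) * Real.log (c.M l) ≤ R l + ε

/-- `Pr{d_U(X_U) ≠ (S_1^n, …, S_{|U|-N}^n)} ≤ ε` whenever `|U| ≥ N + 1`. -/
def Reconstruction (c : SMDCCode L N n α) (μ : ∀ k, Measure (α k)) (ε : ℝ) : Prop :=
  ∀ (U : Finset (Fin L)) (hU : N + 1 ≤ U.card),
    (c.law μ).real {ω | c.dec U hU (c.output U ω) ≠
      fun k : {k : Fin J // N + (k : ℕ) + 1 ≤ U.card} => ω.1 k} ≤ ε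

/-- `H(S_1^n, …, S_J^n | X_A) = H(S_1^n, …, S_J^n)` whenever `|A| ≤ N`. -/
def PerfectSecrecy [∀ k, Fintype (α k)] (c : SMDCCode L N n α) (μ : ∀ k, Measure (α k)) : Prop :=
  ∀ A : Finset (Fin L), A.card ≤ N →
    condEntropy (c.law μ) Prod.fst (c.output A) = entropy (c.law μ) Prod.fst

/-- The code satisfies all three requirements of the `(L, N)` multilevel problem. -/
def Meets [∀ k, Fintype (α k)] (c : SMDCCode L N n α) (μ : ∀ k, Measure (α k))
    (R : Fin L → ℝ) (ε : ℝ) : Prop :=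
  c.RateConstraint R ε ∧ c.Reconstruction μ ε ∧ c.PerfectSecrecy μ

end SMDCCode

/-- The admissible rate region of the `(L, N)` multilevel problem whose sources have letter
distributions `μ k`. -/
def smdcRegion (L N : ℕ) {J : ℕ} {α : Fin J → Type u} [∀ k, Fintype (α k)]
    [∀ k, MeasurableSpace (α k)] (μ : ∀ k, Measure (α k)) : Set (Fin L → ℝ) :=
  {R | (∀ l, 0 ≤ R l) ∧ ∀ ε : ℝ, 0 < ε → ∀ᶠ n : ℕ in atTop, ∃ c : SMDCCode L N n α,
    c.Meets μ R ε}

/-! ### Superposition coding -/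

/-- Superposition coding: source `S_{k+1}` (index `k`) is encoded separately by an
`(L, N, N + k + 1)` single-level code with its own key, the keys of different sources being
independent; encoder `l` outputs `X_l = (X_l^{(1)}, …, X_l^{(J)})`, one of `∏ k, M_l^{(k)}`
values; and every source is decoded from its own components. -/
def superpose {L N n J : ℕ} {α : Fin J → Type u} [∀ k, MeasurableSpace (α k)]
    (c : ∀ k : Fin J, SSDCCode L (N + (k : ℕ) + 1) n (α k)) : SMDCCode L N n α where
  M l := ∏ k, (c k).M l
  Key := ∀ k, (c k).Key
  keyLaw := Measure.pi fun k => (c k).keyLaw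
  enc l ω := finPiFinEquiv fun k => (c k).enc l (ω.1 k, ω.2 k)
  measurable_enc l := by
    refine (measurable_of_countable _).comp (measurable_pi_lambda _ fun k => ?_)
    exact ((c k).measurable_enc l).comp
      (((measurable_pi_apply k).comp measurable_fst).prodMk
        ((measurable_pi_apply k).comp measurable_snd))
  dec U _ x k := (c k).dec U k.2 fun l => finPiFinEquiv.symm (x l) k

/-- The rate tuples that superposition coding achieves, that is, those which satisfy the definition
of admissibility for the `(L, N)` multilevel problem with superposition codes alone. -/
def superpositionAchievable (L N : ℕ) {J : ℕ} {α : Fin J → Type u} [∀ k, Fintype (α k)]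
    [∀ k, MeasurableSpace (α k)] (μ : ∀ k, Measure (α k)) : Set (Fin L → ℝ) :=
  {R | (∀ l, 0 ≤ R l) ∧ ∀ ε : ℝ, 0 < ε → ∀ᶠ n : ℕ in atTop,
    ∃ c : ∀ k : Fin J, SSDCCode L (N + (k : ℕ) + 1) n (α k), (superpose c).Meets μ R ε}

/-- The superposition coding rate region: all sums `R_l = ∑ k, R_l^{(k)}` with `R^{(k)}` admissible
for the `(L, N, N + k)` single-level problem with source `S_k` (here `k` starts at `1`). -/
def superpositionRateRegion (L N : ℕ) {J : ℕ} {α : Fin J → Type u} [∀ k, Fintype (α k)]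
    [∀ k, MeasurableSpace (α k)] (μ : ∀ k, Measure (α k)) : Set (Fin L → ℝ) :=
  {R | ∃ r : Fin J → Fin L → ℝ,
    (∀ k : Fin J, r k ∈ ssdcRegion L N (N + (k : ℕ) + 1) (μ k)) ∧ ∀ l, R l = ∑ k, r k l}

end SecureDiversityCoding

end

/-! Sources are numbered from 0 as in the code: S₀ is needed by every two decoders' worth of
outputs, S₁ only by all three. The three regions are equal because of a cycle of inclusions:
`smdcRegion` ⊆ `superpositionRateRegion` ⊆ `superpositionAchievable` ⊆ `smdcRegion`.

Converse. Fix two outputs X, Y and let W be the third. Secrecy makes (S₀, S₁) independent of W, and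
S₀ is almost determined by (X, W). Up to Fano terms, H(X) ≥ H(X | W) ≥ H(S₀, X | W) = H(S₀) + H(X |
S₀, W), which already gives H(X) ≥ H(S₀). Adding the same bound for Y, subadditivity leaves the term
H(X, Y | S₀, W). All three outputs determine S₁, and S₁ is independent of (S₀, W), so this term is
at least H(S₁). Hence H(X) + H(Y) ≥ 2H(S₀) + H(S₁) (`entropy_le_two_outputs`). The key space may be
infinite, so these inequalities are proved for the law of sources and outputs on a finite space
(`SMDCCode.jointLaw`).

Achievability. Give S₀ the rate H(S₀) on every encoder and leave R_l - H(S₀) to S₁; the pair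
inequalities say that any two of these remainders add up to at least H(S₁). Each source block is
compressed to an index of a typical set, and the index is split by an exact secret sharing scheme
with a uniform key: errors come only from atypical blocks, and secrecy is perfect. For S₀ Shamir's
scheme suffices (`mem_ssdcRegion_two`). For S₁ a scheme with one short and two long shares covers
all unequal rates (`mem_ssdcRegion_three`). In a superposition of codes with independent keys, rates
add, error probabilities obey the union bound, and all entropies in the secrecy condition are sums
over the sources. -/

namespace SecureDiversityCoding

/-! ### Entropy inequalities on finite probability spaces -/

section Entropy

lemma real_preimage_eq_sum {Z β : Type*} [MeasurableSpace Z] [MeasurableSingletonClass Z]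
    [Fintype Z] (ν : Measure Z) [IsProbabilityMeasure ν] [DecidableEq β] (h : Z → β) (b : β) :
    ν.real (h ⁻¹' {b}) = ∑ z with h z = b, ν.real {z} := by
  rw [sum_measureReal_singleton]
  congr 1
  ext z
  simp

lemma real_singleton_le_preimage {Z β : Type*} [MeasurableSpace Z] (ν : Measure Z)
    [IsProbabilityMeasure ν] (h : Z → β) (z : Z) : ν.real {z} ≤ ν.real (h ⁻¹' {h z}) :=
  measureReal_mono (by simp)

variable {Z β γ σ : Type*} [MeasurableSpace Z] [MeasurableSingletonClass Z] [Fintype Z]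
  [Fintype β] [Fintype γ] [Fintype σ] (ν : Measure Z) [IsProbabilityMeasure ν]

lemma sum_real_mul_comp (h : Z → β) (F : β → ℝ) :
    ∑ z, ν.real {z} * F (h z) = ∑ b, ν.real (h ⁻¹' {b}) * F b := by
  classical
  rw [← Finset.sum_fiberwise Finset.univ h]
  refine Finset.sum_congr rfl fun b _ => ?_
  rw [real_preimage_eq_sum, Finset.sum_mul]
  refine Finset.sum_congr rfl fun z hz => ?_
  rw [(Finset.mem_filter.1 hz).2]

lemma sum_real_singleton : ∑ z, ν.real {z} = 1 := by
  rw [sum_measureReal_singleton]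
  simp

lemma sum_real_preimage (h : Z → β) : ∑ b, ν.real (h ⁻¹' {b}) = 1 := by
  have := sum_real_mul_comp ν h fun _ => 1
  simp only [mul_one] at this
  rw [← this, sum_real_singleton]

lemma sum_real_preimage_prod (S : Z → σ) (Y : Z → γ) (y : γ) :
    ∑ s, ν.real ((fun z => (S z, Y z)) ⁻¹' {(s, y)}) = ν.real (Y ⁻¹' {y}) := by
  classical
  have := sum_real_mul_comp ν (fun z => (S z, Y z)) fun b => if b.2 = y then 1 else 0
  rw [Fintype.sum_prod_type] at this
  simp only [mul_ite, mul_one, mul_zero, Finset.sum_ite_eq', Finset.mem_univ, if_true] at this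
  rw [← this, real_preimage_eq_sum, Finset.sum_filter]

lemma entropy_eq_sum (h : Z → β) :
    entropy ν h = ∑ z, ν.real {z} * -Real.log (ν.real (h ⁻¹' {h z})) := by
  rw [sum_real_mul_comp ν h fun b => -Real.log (ν.real (h ⁻¹' {b}))]
  simp [entropy, Real.negMulLog]

/-- Gibbs' inequality for conditional entropies. -/
lemma entropy_prod_sub_le (S : Z → σ) (Y : Z → γ) (q : σ → γ → ℝ) (hq : ∀ s y, 0 ≤ q s y)
    (hq1 : ∀ y, ∑ s, q s y ≤ 1) (hpos : ∀ z, 0 < ν.real {z} → 0 < q (S z) (Y z)) :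
    entropy ν (fun z => (S z, Y z)) - entropy ν Y ≤
      ∑ z, ν.real {z} * -Real.log (q (S z) (Y z)) := by
  set m : σ × γ → ℝ := fun b => ν.real ((fun z => (S z, Y z)) ⁻¹' {b}) with hm
  set w : γ → ℝ := fun y => ν.real (Y ⁻¹' {y}) with hw
  have hm0 : ∀ b, 0 ≤ m b := fun b => measureReal_nonneg
  have hw0 : ∀ b, 0 ≤ w b := fun b => measureReal_nonneg
  rw [entropy_eq_sum, entropy_eq_sum, ← Finset.sum_sub_distrib, ← sub_nonpos,
    ← Finset.sum_sub_distrib]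
  -- The bound log t ≤ t - 1 at t = w q / m, weighted by the mass of `z`; points of mass zero drop
  -- out.
  have key : ∀ z, ν.real {z} * -Real.log (m (S z, Y z)) - ν.real {z} * -Real.log (w (Y z)) -
      ν.real {z} * -Real.log (q (S z) (Y z)) ≤
      ν.real {z} * (w (Y z) * q (S z) (Y z) / m (S z, Y z)) - ν.real {z} := by
    intro z
    rcases (measureReal_nonneg : 0 ≤ ν.real {z}).eq_or_lt with h0 | h0
    · simp [← h0]
    have h1 : 0 < m (S z, Y z) := h0.trans_le (real_singleton_le_preimage ν (fun z => (S z, Y z)) z)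
    have h2 : 0 < w (Y z) := h0.trans_le (real_singleton_le_preimage ν Y z)
    have h3 := hpos z h0
    have h4 := Real.log_le_sub_one_of_pos (div_pos (mul_pos h2 h3) h1)
    rw [Real.log_div (mul_pos h2 h3).ne' h1.ne', Real.log_mul h2.ne' h3.ne'] at h4
    nlinarith [mul_le_mul_of_nonneg_left h4 h0.le]
  refine (Finset.sum_le_sum fun z _ => key z).trans ?_
  rw [Finset.sum_sub_distrib, sum_real_singleton,
    sum_real_mul_comp ν (fun z => (S z, Y z)) fun b => w b.2 * q b.1 b.2 / m b, sub_nonpos]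
  calc ∑ b, m b * (w b.2 * q b.1 b.2 / m b) ≤ ∑ b : σ × γ, w b.2 * q b.1 b.2 := by
        refine Finset.sum_le_sum fun b _ => ?_
        rcases (hm0 b).eq_or_lt with h0 | h0
        · rw [← h0, zero_mul]
          exact mul_nonneg (hw0 _) (hq _ _)
        · rw [mul_div_cancel₀ _ h0.ne']
    _ = ∑ y, w y * ∑ s, q s y := by
        rw [Fintype.sum_prod_type_right]
        simp [Finset.mul_sum]
    _ ≤ ∑ y, w y * 1 := by
        gcongr with y _
        exact hq1 y
    _ = 1 := by simpa using sum_real_preimage ν Y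

/-- Conditioning reduces entropy. -/
lemma entropy_submodular (X : Z → σ) (Y : Z → β) (W : Z → γ) :
    entropy ν (fun z => (X z, (Y z, W z))) - entropy ν (fun z => (Y z, W z)) ≤
      entropy ν (fun z => (X z, W z)) - entropy ν W := by
  -- Gibbs' inequality against the conditional law of X given W alone, which ignores the value of Y.
  refine (entropy_prod_sub_le ν X (fun z => (Y z, W z)) (fun x b =>
    ν.real ((fun z => (X z, W z)) ⁻¹' {(x, b.2)}) / ν.real (W ⁻¹' {b.2}))
    (fun _ _ => by positivity) (fun b => ?_) fun z hz => ?_).trans_eq ?_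
  · rw [← Finset.sum_div, sum_real_preimage_prod]
    exact div_self_le_one _
  · exact div_pos (hz.trans_le (real_singleton_le_preimage ν (fun z => (X z, W z)) z))
      (hz.trans_le (real_singleton_le_preimage ν W z))
  · rw [entropy_eq_sum, entropy_eq_sum, ← Finset.sum_sub_distrib]
    refine Finset.sum_congr rfl fun z _ => ?_
    rcases (measureReal_nonneg : 0 ≤ ν.real {z}).eq_or_lt with h0 | h0
    · simp [← h0]
    · rw [Real.log_div (h0.trans_le (real_singleton_le_preimage ν (fun z => (X z, W z)) z)).ne'
        (h0.trans_le (real_singleton_le_preimage ν W z)).ne']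
      ring

/-- A random variable that is determined by another one has smaller entropy. -/
lemma entropy_le_of_determined (f : Z → β) (g : Z → γ) (h : ∀ z z', f z = f z' → g z = g z') :
    entropy ν g ≤ entropy ν f := by
  rw [entropy_eq_sum, entropy_eq_sum]
  refine Finset.sum_le_sum fun z _ => ?_
  rcases (measureReal_nonneg : 0 ≤ ν.real {z}).eq_or_lt with h0 | h0
  · simp [← h0]
  exact mul_le_mul_of_nonneg_left (neg_le_neg (Real.log_le_log
    (h0.trans_le (real_singleton_le_preimage ν f z)) (measureReal_mono fun x hx => h x z hx))) h0.le

lemma entropy_comp_le (f : Z → β) (g : β → γ) : entropy ν (fun z => g (f z)) ≤ entropy ν f :=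
  entropy_le_of_determined ν f _ fun _ _ h => congrArg g h

lemma entropy_const (c : β) : entropy ν (fun _ => c) = 0 := by
  rw [entropy_eq_sum]
  simp

/-- Conditional entropy is at most entropy. -/
lemma entropy_prod_le (X : Z → σ) (Y : Z → β) :
    entropy ν (fun z => (X z, Y z)) ≤ entropy ν X + entropy ν Y := by
  have h := entropy_submodular ν X Y fun _ => ()
  have h1 := entropy_comp_le ν (fun z => (X z, (Y z, ()))) fun b => (b.1, b.2.1)
  have h2 := entropy_comp_le ν Y fun b => (b, ())
  have h3 := entropy_comp_le ν X fun b => (b, ())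
  have h4 := entropy_const ν ()
  simp only at h1
  linarith

/-- Gibbs' inequality against the uniform law, with a constant as the conditioning variable. -/
lemma entropy_le_log_card (X : Z → σ) : entropy ν X ≤ Real.log (Fintype.card σ) := by
  obtain ⟨z⟩ : Nonempty Z := ν.nonempty_of_neZero
  have hc : (0 : ℝ) < Fintype.card σ := by
    have : Nonempty σ := ⟨X z⟩
    exact_mod_cast Fintype.card_pos
  have h := entropy_prod_sub_le ν X (fun _ => ()) (fun _ _ => 1 / (Fintype.card σ : ℝ))
    (fun _ _ => by positivity) (fun _ => by simp [hc.ne']) fun _ _ => by positivity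
  rw [← Finset.sum_mul, sum_real_singleton, entropy_const ν ()] at h
  have h1 := entropy_comp_le ν (fun z => (X z, ())) fun b => b.1
  simp only [one_div, Real.log_inv] at h h1
  linarith

/-- Fano's inequality. -/
lemma entropy_prod_sub_le_of_decoder (S : Z → σ) (Y : Z → γ) (d : γ → σ) {ε : ℝ}
    (h : ν.real {z | d (Y z) ≠ S z} ≤ ε) :
    entropy ν (fun z => (S z, Y z)) - entropy ν Y ≤
      Real.log 2 + ε * Real.log (Fintype.card σ) := by
  classical
  obtain ⟨z⟩ : Nonempty Z := ν.nonempty_of_neZero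
  have hc1 : (1 : ℝ) ≤ Fintype.card σ := by
    have : Nonempty σ := ⟨S z⟩
    exact_mod_cast Fintype.card_pos
  have hc : (0 : ℝ) < Fintype.card σ := by linarith
  have hq : ∀ s y, 0 < if s = d y then (1 / 2 : ℝ) else 1 / (2 * Fintype.card σ) := by
    intro s y
    split_ifs <;> positivity
  -- The comparison kernel puts mass 1/2 on the decoder's guess and 1/(2|σ|) on every other value:
  -- its log-loss is log 2 when the guess is right and log 2 + log |σ| when it is wrong.
  refine (entropy_prod_sub_le ν S Y (fun s y => if s = d y then (1 / 2 : ℝ) else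
    1 / (2 * Fintype.card σ)) (fun s y => (hq s y).le) (fun y => ?_)
    fun z _ => hq _ _).trans ?_
  · calc ∑ s, (if s = d y then (1 / 2 : ℝ) else 1 / (2 * Fintype.card σ))
        ≤ ∑ s, ((if s = d y then (1 / 2 : ℝ) else 0) + 1 / (2 * Fintype.card σ)) := by
          refine Finset.sum_le_sum fun s _ => ?_
          split_ifs
          · have : (0 : ℝ) ≤ 1 / (2 * Fintype.card σ) := by positivity
            linarith
          · simp
      _ = 1 := by
          rw [Finset.sum_add_distrib]
          simp only [Finset.sum_ite_eq', Finset.mem_univ, if_true, Finset.sum_const,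
            Finset.card_univ, nsmul_eq_mul]
          field_simp
          norm_num
  · have h1 : ∀ z, ν.real {z} * -Real.log (if S z = d (Y z) then (1 / 2 : ℝ) else
        1 / (2 * Fintype.card σ)) = ν.real {z} * Real.log 2 +
        (if d (Y z) ≠ S z then ν.real {z} else 0) * Real.log (Fintype.card σ) := by
      intro z
      by_cases hz : S z = d (Y z)
      · simp [hz]
      · have : d (Y z) ≠ S z := Ne.symm hz
        rw [if_neg hz, if_pos this, one_div, Real.log_inv, Real.log_mul two_ne_zero hc.ne']
        ring
    rw [Finset.sum_congr rfl fun z _ => h1 z, Finset.sum_add_distrib, ← Finset.sum_mul,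
      ← Finset.sum_mul, sum_real_singleton, one_mul, ← Finset.sum_filter,
      sum_measureReal_singleton]
    have h2 : ((Finset.univ.filter fun z => d (Y z) ≠ S z : Finset Z) : Set Z) =
        {z | d (Y z) ≠ S z} := by ext; simp
    rw [h2]
    have := mul_le_mul_of_nonneg_right h (Real.log_nonneg hc1)
    linarith

end Entropy

/-! ### Transfer to finite laws, and the chain rule -/

section Bridge

variable {Ω β γ : Type*} [MeasurableSpace Ω] [Fintype β] [Fintype γ]

/-- Entropies only depend on the law of a random variable. -/
lemma entropy_map {Z : Type*} [MeasurableSpace Z] [MeasurableSingletonClass Z] [Fintype Z]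
    (μ : Measure Ω) {T : Ω → Z} (hT : Measurable T) (f : Z → β) :
    entropy (μ.map T) f = entropy μ (fun ω => f (T ω)) := by
  refine Finset.sum_congr rfl fun b _ => ?_
  rw [map_measureReal_apply hT (Set.toFinite _).measurableSet]
  rfl

/-- The chain rule. -/
lemma condEntropy_eq [MeasurableSpace β] [MeasurableSingletonClass β] [MeasurableSpace γ]
    [MeasurableSingletonClass γ] (μ : Measure Ω) [IsProbabilityMeasure μ]
    {X : Ω → β} {Y : Ω → γ} (hX : Measurable X) (hY : Measurable Y) :
    condEntropy μ X Y = entropy μ (fun ω => (X ω, Y ω)) - entropy μ Y := by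
  have hpair : ∀ b c, (fun ω => (X ω, Y ω)) ⁻¹' {(b, c)} = Y ⁻¹' {c} ∩ X ⁻¹' {b} := by
    intro b c
    ext ω
    simp [and_comm]
  have hsum : ∀ c, ∑ b, μ.real ((fun ω => (X ω, Y ω)) ⁻¹' {(b, c)}) = μ.real (Y ⁻¹' {c}) := by
    intro c
    have : IsProbabilityMeasure (μ.map fun ω => (X ω, Y ω)) :=
      Measure.isProbabilityMeasure_map (hX.prodMk hY).aemeasurable
    have h := sum_real_preimage_prod (μ.map fun ω => (X ω, Y ω)) Prod.fst Prod.snd c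
    rw [map_measureReal_apply (hX.prodMk hY) (Set.toFinite _).measurableSet] at h
    refine Eq.trans (Finset.sum_congr rfl fun b _ => ?_) h
    rw [map_measureReal_apply (hX.prodMk hY) (Set.toFinite _).measurableSet]
    rfl
  rw [condEntropy, entropy, entropy, Fintype.sum_prod_type_right, ← Finset.sum_sub_distrib]
  refine Finset.sum_congr rfl fun c _ => ?_
  have hcond : ∀ b, (ProbabilityTheory.cond μ (Y ⁻¹' {c})).real (X ⁻¹' {b}) =
      (μ.real (Y ⁻¹' {c}))⁻¹ * μ.real ((fun ω => (X ω, Y ω)) ⁻¹' {(b, c)}) := by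
    intro b
    rw [hpair, Measure.real, ProbabilityTheory.cond_apply (hY (measurableSet_singleton c)),
      ENNReal.toReal_mul, ENNReal.toReal_inv, Measure.real, Measure.real]
  -- A fibre of probability zero contributes zero to both sides, so the value of `cond` on it does
  -- not matter.
  rcases eq_or_ne (μ.real (Y ⁻¹' {c})) 0 with h0 | h0
  · have h1 : ∀ b, μ.real ((fun ω => (X ω, Y ω)) ⁻¹' {(b, c)}) = 0 := fun b =>
      le_antisymm (h0 ▸ (hpair b c ▸ measureReal_mono Set.inter_subset_left)) measureReal_nonneg
    simp [h0, h1]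
  · simp only [entropy, hcond, Real.negMulLog_mul]
    rw [Finset.sum_add_distrib, ← Finset.sum_mul, hsum, ← Finset.mul_sum]
    simp only [Real.negMulLog, Real.log_inv]
    field_simp
    ring

end Bridge

/-! ### Additivity of entropy for product measures -/

section Product

/-- Entropies of independent random variables add up. -/
lemma sum_negMulLog_prod {ι : Type*} [Fintype ι] [DecidableEq ι] {β : ι → Type*}
    [∀ i, Fintype (β i)] (p : ∀ i, β i → ℝ)
    (h1 : ∀ i, ∑ b, p i b = 1) :
    ∑ s : ∀ i, β i, Real.negMulLog (∏ i, p i (s i)) = ∑ i, ∑ b, Real.negMulLog (p i b) := by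
  -- `negMulLog` obeys the Leibniz rule. Each summand is again a product over `i`, so its sum over
  -- all `s` factorises, and every factor except the one at `j` sums to 1.
  have key : ∀ s : ∀ i, β i, Real.negMulLog (∏ i, p i (s i)) =
      ∑ j, ∏ i, (if i = j then Real.negMulLog (p i (s i)) else p i (s i)) := by
    intro s
    have h2 : ∀ j, ∏ i, (if i = j then Real.negMulLog (p i (s i)) else p i (s i)) =
        -Real.log (p j (s j)) * ∏ i, p i (s i) := by
      intro j
      rw [← Finset.mul_prod_erase _ _ (Finset.mem_univ j),
        ← Finset.mul_prod_erase (s := Finset.univ) (fun i => p i (s i)) (Finset.mem_univ j),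
        if_pos rfl, Finset.prod_congr rfl fun i hi => if_neg (Finset.ne_of_mem_erase hi),
        Real.negMulLog]
      ring
    rw [Finset.sum_congr rfl fun j _ => h2 j, ← Finset.sum_mul, Real.negMulLog]
    by_cases h : ∃ i, p i (s i) = 0
    · obtain ⟨i, hi⟩ := h
      rw [Finset.prod_eq_zero (Finset.mem_univ i) hi]
      simp
    · push Not at h
      rw [Real.log_prod fun i _ => h i, Finset.sum_neg_distrib]
      ring
  rw [Finset.sum_congr rfl fun s _ => key s, Finset.sum_comm]
  refine Finset.sum_congr rfl fun j _ => ?_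
  rw [← Fintype.prod_sum fun i b => if i = j then Real.negMulLog (p i b) else p i b,
    ← Finset.mul_prod_erase _ _ (Finset.mem_univ j), Finset.prod_eq_one, mul_one]
  · simp
  · intro i hi
    simp [Finset.ne_of_mem_erase hi, h1]

lemma entropy_pi {ι : Type*} [Fintype ι] [DecidableEq ι] {β : ι → Type*} [∀ i, Fintype (β i)]
    [∀ i, MeasurableSpace (β i)] [∀ i, MeasurableSingletonClass (β i)] (μ : ∀ i, Measure (β i))
    [∀ i, IsProbabilityMeasure (μ i)] :
    entropy (Measure.pi μ) (fun s => s) = ∑ i, entropy (μ i) (fun b => b) := by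
  have := sum_negMulLog_prod (fun i b => (μ i).real {b}) fun i => sum_real_singleton (μ i)
  simp only [entropy]
  refine Eq.trans ?_ this
  refine Finset.sum_congr rfl fun s _ => ?_
  congr 1
  simp [Measure.real, Measure.pi_singleton, ENNReal.toReal_prod]

end Product

/-! ### The entropy inequalities behind the converse -/

section Converse

variable {Z σ₀ σ₁ χ ψ ω : Type*} [MeasurableSpace Z] [MeasurableSingletonClass Z] [Fintype Z]
  [Fintype σ₀] [Fintype σ₁] [Fintype χ] [Fintype ψ] [Fintype ω]
  (ν : Measure Z) [IsProbabilityMeasure ν]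

/-- If the pair (S₀, S₁) is independent of W, so is S₀: dropping S₁ from H(S₀, S₁, W) loses at most
H(S₁). -/
lemma entropy_add_le_of_secrecy (S₀ : Z → σ₀) (S₁ : Z → σ₁) (W : Z → ω)
    (hind : entropy ν (fun z => (S₀ z, S₁ z)) = entropy ν S₀ + entropy ν S₁)
    (hsec : entropy ν (fun z => ((S₀ z, S₁ z), W z)) - entropy ν W =
      entropy ν (fun z => (S₀ z, S₁ z))) :
    entropy ν S₀ + entropy ν W ≤ entropy ν (fun z => (S₀ z, W z)) := by
  have h1 := entropy_prod_le ν S₁ fun z => (S₀ z, W z)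
  have h2 := entropy_comp_le ν (fun z => (S₁ z, (S₀ z, W z))) fun b => ((b.2.1, b.1), b.2.2)
  simp only at h2
  linarith

/-- H(X) ≥ H(X | W), and including S₀, which (X, W) nearly determines, raises the conditional
entropy by at most δ. H(S₀, X, W) is kept whole because the pair bound uses more of it than H(S₀,
W). -/
lemma entropy_output_ge (S₀ : Z → σ₀) (X : Z → χ) (W : Z → ω) {δ : ℝ}
    (hX : entropy ν (fun z => (S₀ z, (X z, W z))) - entropy ν (fun z => (X z, W z)) ≤ δ) :
    entropy ν (fun z => (S₀ z, (X z, W z))) - entropy ν W - δ ≤ entropy ν X := by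
  have h1 := entropy_prod_le ν X W
  linarith

lemma entropy_le_output (S₀ : Z → σ₀) (X : Z → χ) (W : Z → ω) {δ : ℝ}
    (hsec : entropy ν S₀ + entropy ν W ≤ entropy ν (fun z => (S₀ z, W z)))
    (hX : entropy ν (fun z => (S₀ z, (X z, W z))) - entropy ν (fun z => (X z, W z)) ≤ δ) :
    entropy ν S₀ - δ ≤ entropy ν X := by
  have h1 := entropy_output_ge ν S₀ X W hX
  have h2 := entropy_comp_le ν (fun z => (S₀ z, (X z, W z))) fun b => (b.1, b.2.2)
  simp only at h2
  linarith

/-- The bounds for X and Y are joined by submodularity over (S₀, W): H(S₀, X, W) + H(S₀, Y, W) ≥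
H(S₀, X, Y, W) + H(S₀, W). The second term on the right yields another H(S₀) by secrecy. The first
is at least H(X, Y, W), hence at least H(S₀, S₁, W) - δ', which secrecy evaluates. -/
lemma entropy_le_two_outputs (S₀ : Z → σ₀) (S₁ : Z → σ₁) (X : Z → χ) (Y : Z → ψ) (W : Z → ω)
    {δ δ' : ℝ} (hind : entropy ν (fun z => (S₀ z, S₁ z)) = entropy ν S₀ + entropy ν S₁)
    (hsec : entropy ν (fun z => ((S₀ z, S₁ z), W z)) - entropy ν W =
      entropy ν (fun z => (S₀ z, S₁ z)))
    (hX : entropy ν (fun z => (S₀ z, (X z, W z))) - entropy ν (fun z => (X z, W z)) ≤ δ)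
    (hY : entropy ν (fun z => (S₀ z, (Y z, W z))) - entropy ν (fun z => (Y z, W z)) ≤ δ)
    (hXY : entropy ν (fun z => ((S₀ z, S₁ z), (X z, (Y z, W z)))) -
      entropy ν (fun z => (X z, (Y z, W z))) ≤ δ') :
    2 * entropy ν S₀ + entropy ν S₁ - 2 * δ - δ' ≤ entropy ν X + entropy ν Y := by
  have h1 := entropy_output_ge ν S₀ X W hX
  have h2 := entropy_output_ge ν S₀ Y W hY
  have h3 := entropy_add_le_of_secrecy ν S₀ S₁ W hind hsec
  have h4 := entropy_submodular ν X Y fun z => (S₀ z, W z)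
  have h5 := entropy_comp_le ν (fun z => (X z, (Y z, (S₀ z, W z)))) fun b =>
    (b.1, (b.2.1, b.2.2.2))
  have h6 := entropy_comp_le ν (fun z => (S₀ z, (X z, W z))) fun b => (b.2.1, (b.1, b.2.2))
  have h7 := entropy_comp_le ν (fun z => (S₀ z, (Y z, W z))) fun b => (b.2.1, (b.1, b.2.2))
  have h8 := entropy_comp_le ν (fun z => ((S₀ z, S₁ z), (X z, (Y z, W z)))) fun b =>
    (b.1, b.2.2.2)
  simp only at h5 h6 h7 h8
  linarith

end Converse

section Blocks

variable {α : Type u} [Fintype α] [MeasurableSpace α] [MeasurableSingletonClass α]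

lemma entropy_block (μ : Measure α) [IsProbabilityMeasure μ] (n : ℕ) :
    entropy (Measure.pi fun _ : Fin n => μ) (fun s => s) = n * sourceEntropy μ := by
  rw [entropy_pi]
  simp [sourceEntropy, Function.id_def]

end Blocks

/-! ### The finite joint law of sources and outputs of a multilevel code -/

namespace SMDCCode

variable {L N n J : ℕ} {α : Fin J → Type u} [∀ k, MeasurableSpace (α k)]

instance isProbabilityMeasure_law (c : SMDCCode L N n α) (μ : ∀ k, Measure (α k))
    [∀ k, IsProbabilityMeasure (μ k)] : IsProbabilityMeasure (c.law μ) := by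
  unfold law
  infer_instance

/-- The sources together with all encoder outputs. -/
def observe (c : SMDCCode L N n α) (ω : (∀ k, Fin n → α k) × c.Key) :
    (∀ k, Fin n → α k) × (∀ l, Fin (c.M l)) :=
  (ω.1, fun l => c.enc l ω)

lemma measurable_observe (c : SMDCCode L N n α) : Measurable c.observe :=
  measurable_fst.prodMk (measurable_pi_lambda _ fun l => c.measurable_enc l)

/-- The joint law of the sources and the encoder outputs. -/
noncomputable def jointLaw (c : SMDCCode L N n α) (μ : ∀ k, Measure (α k)) :
    Measure ((∀ k, Fin n → α k) × (∀ l, Fin (c.M l))) :=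
  (c.law μ).map c.observe

/-- The restriction of all encoder outputs to the index set `U`. -/
def part (c : SMDCCode L N n α) (U : Finset (Fin L))
    (z : (∀ k, Fin n → α k) × (∀ l, Fin (c.M l))) : ∀ l : U, Fin (c.M l) :=
  fun l => z.2 l

variable [∀ k, Fintype (α k)] [∀ k, MeasurableSingletonClass (α k)] (c : SMDCCode L N n α)
  (μ : ∀ k, Measure (α k))

lemma entropy_jointLaw_source {β : Type*} [Fintype β] (f : (∀ k, Fin n → α k) → β) :
    entropy (c.jointLaw μ) (fun z => f z.1) =
      entropy (Measure.pi fun k => Measure.pi fun _ : Fin n => μ k) f := by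
  have h1 := entropy_map (c.law μ) c.measurable_observe fun z => f z.1
  have h2 := entropy_map (c.law μ) measurable_fst f
  rw [jointLaw, h1]
  rw [law, Measure.map_fst_prod] at h2
  simpa [law, observe] using h2.symm

variable [∀ k, IsProbabilityMeasure (μ k)]

instance isProbabilityMeasure_jointLaw : IsProbabilityMeasure (c.jointLaw μ) :=
  Measure.isProbabilityMeasure_map c.measurable_observe.aemeasurable

lemma entropy_jointLaw_sources :
    entropy (c.jointLaw μ) (fun z => z.1) = ∑ k, n * sourceEntropy (μ k) := by
  rw [entropy_jointLaw_source c μ fun s => s, entropy_pi]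
  exact Finset.sum_congr rfl fun k _ => entropy_block (μ k) n

lemma entropy_jointLaw_source_apply (k : Fin J) :
    entropy (c.jointLaw μ) (fun z => z.1 k) = n * sourceEntropy (μ k) := by
  rw [entropy_jointLaw_source c μ fun s => s k, ← entropy_block (μ k) n,
    ← (measurePreserving_eval (fun k => Measure.pi fun _ : Fin n => μ k) k).map_eq,
    entropy_map _ (measurable_pi_apply k)]

variable {c μ}

lemma PerfectSecrecy.jointLaw (h : c.PerfectSecrecy μ) {A : Finset (Fin L)} (hA : A.card ≤ N) :
    entropy (c.jointLaw μ) (fun z => (z.1, c.part A z)) - entropy (c.jointLaw μ) (c.part A) =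
      entropy (c.jointLaw μ) (fun z => z.1) := by
  have h1 := h A hA
  rw [condEntropy_eq _ (Y := c.output A) measurable_fst
    (measurable_pi_lambda _ fun l => c.measurable_enc l)] at h1
  simp only [SMDCCode.jointLaw, entropy_map _ c.measurable_observe]
  exact h1

/-- Fano's inequality for the decoder `p ∘ d_U`. The function `p` repackages the family of decoded
sources as a single variable or an ordered pair. -/
lemma Reconstruction.jointLaw {ε : ℝ} (h : c.Reconstruction μ ε) {U : Finset (Fin L)}
    (hU : N + 1 ≤ U.card) {β : Type*} [Fintype β]
    (p : (∀ k : {k : Fin J // N + (k : ℕ) + 1 ≤ U.card}, Fin n → α k) → β) :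
    entropy (c.jointLaw μ) (fun z => (p fun k => z.1 k, c.part U z)) -
      entropy (c.jointLaw μ) (c.part U) ≤ Real.log 2 + ε * Real.log (Fintype.card β) := by
  refine entropy_prod_sub_le_of_decoder (c.jointLaw μ) (fun z => p fun k => z.1 k) (c.part U)
    (fun x => p (c.dec U hU x)) ?_
  rw [SMDCCode.jointLaw, map_measureReal_apply c.measurable_observe
    (Set.toFinite _).measurableSet]
  refine (measureReal_mono fun ω hω => ?_).trans (h U hU)
  exact fun h' => hω (congrArg p h')

lemma RateConstraint.entropy_le {R : Fin L → ℝ} {ε : ℝ} (h : c.RateConstraint R ε) (hn : 0 < n)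
    (l : Fin L) : entropy (c.jointLaw μ) (fun z => z.2 l) ≤ n * (R l + ε) := by
  have h1 := entropy_le_log_card (c.jointLaw μ) fun z => z.2 l
  rw [Fintype.card_fin] at h1
  have h2 := h l
  have hn' : (0 : ℝ) < n := by exact_mod_cast hn
  rw [one_div, inv_mul_le_iff₀ hn'] at h2
  linarith

end SMDCCode

/-! ### The converse bounds for three encoders -/

namespace SMDCCode

variable {n : ℕ} {α : Fin 2 → Type u} [∀ k, Fintype (α k)] [∀ k, MeasurableSpace (α k)]
  [∀ k, MeasurableSingletonClass (α k)] {c : SMDCCode 3 1 n α} {μ : ∀ k, Measure (α k)}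
  [∀ k, IsProbabilityMeasure (μ k)] {R : Fin 3 → ℝ} {ε : ℝ}

/-- The family of outputs indexed by `{i, w}` and the ordered pair of outputs determine each other,
so Fano's bound passes from one to the other. -/
lemma Reconstruction.entropy_pair (h : c.Reconstruction μ ε) {i w : Fin 3} (hiw : i ≠ w) :
    entropy (c.jointLaw μ) (fun z => (z.1 0, (z.2 i, z.2 w))) -
      entropy (c.jointLaw μ) (fun z => (z.2 i, z.2 w)) ≤
      Real.log 2 + ε * (n * Real.log (Fintype.card (α 0))) := by
  have hU : ({i, w} : Finset (Fin 3)).card = 2 := Finset.card_pair hiw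
  have h1 := h.jointLaw (U := {i, w}) hU.ge fun s => s ⟨0, by simp [hU]⟩
  have h2 := entropy_le_of_determined (c.jointLaw μ)
    (fun z => (z.1 0, c.part {i, w} z)) (fun z => (z.1 0, (z.2 i, z.2 w))) fun z z' hz => by
      simp only [Prod.mk.injEq] at hz ⊢
      exact ⟨hz.1, congrFun hz.2 ⟨i, by simp⟩, congrFun hz.2 ⟨w, by simp⟩⟩
  have h3 := entropy_le_of_determined (c.jointLaw μ)
    (fun z => (z.2 i, z.2 w)) (c.part {i, w}) fun z z' hz => by
      simp only [Prod.mk.injEq] at hz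
      funext ⟨l, hl⟩
      rcases Finset.mem_insert.1 hl with rfl | hl
      · exact hz.1
      · obtain rfl := Finset.mem_singleton.1 hl
        exact hz.2
  have h4 : Real.log (Fintype.card (Fin n → α 0)) = n * Real.log (Fintype.card (α 0)) := by
    simp
  rw [h4] at h1
  linarith

lemma Reconstruction.entropy_triple (h : c.Reconstruction μ ε) {i j w : Fin 3}
    (hU : ({i, j, w} : Finset (Fin 3)) = Finset.univ) :
    entropy (c.jointLaw μ) (fun z => ((z.1 0, z.1 1), (z.2 i, (z.2 j, z.2 w)))) -
      entropy (c.jointLaw μ) (fun z => (z.2 i, (z.2 j, z.2 w))) ≤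
      Real.log 2 + ε * (n * Real.log (Fintype.card (α 0)) +
        n * Real.log (Fintype.card (α 1))) := by
  have hz : ∀ z z' : (∀ k, Fin n → α k) × (∀ l, Fin (c.M l)),
      (z.2 i, (z.2 j, z.2 w)) = (z'.2 i, (z'.2 j, z'.2 w)) →
      c.part Finset.univ z = c.part Finset.univ z' := by
    intro z z' hz
    simp only [Prod.mk.injEq] at hz
    funext ⟨l, hl⟩
    rw [← hU] at hl
    simp only [Finset.mem_insert, Finset.mem_singleton] at hl
    rcases hl with rfl | rfl | rfl
    exacts [hz.1, hz.2.1, hz.2.2]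
  have h1 := h.jointLaw (U := Finset.univ) (by simp) fun s =>
    (s ⟨0, by simp⟩, s ⟨1, by simp⟩)
  have h2 := entropy_le_of_determined (c.jointLaw μ)
    (fun z => ((z.1 0, z.1 1), c.part Finset.univ z))
    (fun z => ((z.1 0, z.1 1), (z.2 i, (z.2 j, z.2 w)))) fun z z' hz => by
      simp only [Prod.mk.injEq] at hz ⊢
      exact ⟨hz.1, congrFun hz.2 ⟨i, by simp⟩, congrFun hz.2 ⟨j, by simp⟩,
        congrFun hz.2 ⟨w, by simp⟩⟩
  have h3 := entropy_le_of_determined (c.jointLaw μ) _ (c.part Finset.univ) hz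
  have hne : ∀ k, Nonempty (α k) := fun k => (μ k).nonempty_of_neZero
  have h4 : Real.log (Fintype.card ((Fin n → α 0) × (Fin n → α 1))) =
      n * Real.log (Fintype.card (α 0)) + n * Real.log (Fintype.card (α 1)) := by
    rw [Fintype.card_prod, Nat.cast_mul, Real.log_mul (by simp) (by simp)]
    simp
  rw [h4] at h1
  linarith

/-- Independence of the two sources, in the form in which the converse uses it. -/
lemma entropy_jointLaw_pair :
    entropy (c.jointLaw μ) (fun z => (z.1 0, z.1 1)) =
      entropy (c.jointLaw μ) (fun z => z.1 0) + entropy (c.jointLaw μ) (fun z => z.1 1) := by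
  have h1 := entropy_comp_le (c.jointLaw μ) (fun z => z.1) fun s => (s 0, s 1)
  have h2 := entropy_le_of_determined (c.jointLaw μ) (fun z => (z.1 0, z.1 1)) (fun z => z.1)
    fun z z' hz => by
      simp only [Prod.mk.injEq] at hz
      funext k
      fin_cases k
      exacts [hz.1, hz.2]
  have h3 := entropy_jointLaw_sources c μ
  rw [Fin.sum_univ_two] at h3
  rw [entropy_jointLaw_source_apply, entropy_jointLaw_source_apply]
  linarith

lemma PerfectSecrecy.entropy_single (h : c.PerfectSecrecy μ) (w : Fin 3) :
    entropy (c.jointLaw μ) (fun z => ((z.1 0, z.1 1), z.2 w)) -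
      entropy (c.jointLaw μ) (fun z => z.2 w) =
      entropy (c.jointLaw μ) (fun z => (z.1 0, z.1 1)) := by
  have h1 := h.jointLaw (A := {w}) (by simp)
  have hp : ∀ z z' : (∀ k, Fin n → α k) × (∀ l, Fin (c.M l)),
      c.part {w} z = c.part {w} z' ↔ z.2 w = z'.2 w := by
    refine fun z z' => ⟨fun h => congrFun h ⟨w, by simp⟩, fun h => ?_⟩
    funext ⟨l, hl⟩
    obtain rfl := Finset.mem_singleton.1 hl
    exact h
  have hs : ∀ z z' : (∀ k, Fin n → α k) × (∀ l, Fin (c.M l)),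
      z.1 = z'.1 ↔ z.1 0 = z'.1 0 ∧ z.1 1 = z'.1 1 := fun z z' => by
    rw [funext_iff, Fin.forall_fin_two]
  have h2 := entropy_jointLaw_pair (c := c) (μ := μ)
  have e1 : entropy (c.jointLaw μ) (fun z => ((z.1 0, z.1 1), z.2 w)) =
      entropy (c.jointLaw μ) (fun z => (z.1, c.part {w} z)) :=
    le_antisymm (entropy_le_of_determined _ _ _ fun z z' hz => by
      simpa only [Prod.mk.injEq, hs, hp] using hz) (entropy_le_of_determined _ _ _ fun z z' hz => by
      simpa only [Prod.mk.injEq, hs, hp] using hz)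
  have e2 : entropy (c.jointLaw μ) (fun z => z.2 w) = entropy (c.jointLaw μ) (c.part {w}) :=
    le_antisymm (entropy_le_of_determined _ _ _ fun z z' hz => by simpa only [hp] using hz)
      (entropy_le_of_determined _ _ _ fun z z' hz => by simpa only [hp] using hz)
  have e3 : entropy (c.jointLaw μ) (fun z => (z.1 0, z.1 1)) =
      entropy (c.jointLaw μ) (fun z => z.1) :=
    le_antisymm (entropy_le_of_determined _ _ _ fun z z' hz => by
      simpa only [Prod.mk.injEq, hs] using hz) (entropy_le_of_determined _ _ _ fun z z' hz => by
      simpa only [Prod.mk.injEq, hs] using hz)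
  rw [e1, e2, e3, h1]

lemma Meets.single_bound (h : c.Meets μ R ε) (hn : 0 < n) {i w : Fin 3} (hiw : i ≠ w) :
    sourceEntropy (μ 0) ≤
      R i + Real.log 2 * (1 / (n : ℝ)) + (1 + Real.log (Fintype.card (α 0))) * ε := by
  have h0 := entropy_add_le_of_secrecy (c.jointLaw μ) (fun z => z.1 0) (fun z => z.1 1)
    (fun z => z.2 w) entropy_jointLaw_pair (h.2.2.entropy_single w)
  have h1 := entropy_le_output (c.jointLaw μ) (fun z => z.1 0) (fun z => z.2 i) (fun z => z.2 w)
    h0 (h.2.1.entropy_pair hiw)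
  have h2 := h.1.entropy_le (μ := μ) hn i
  rw [entropy_jointLaw_source_apply] at h1
  have hn' : (0 : ℝ) < n := by exact_mod_cast hn
  refine le_of_mul_le_mul_left ?_ hn'
  field_simp
  linarith

lemma Meets.pair_bound (h : c.Meets μ R ε) (hn : 0 < n) {i j w : Fin 3} (hiw : i ≠ w)
    (hjw : j ≠ w) (hU : ({i, j, w} : Finset (Fin 3)) = Finset.univ) :
    2 * sourceEntropy (μ 0) + sourceEntropy (μ 1) ≤
      R i + R j + 3 * Real.log 2 * (1 / (n : ℝ)) +
        (2 + 3 * Real.log (Fintype.card (α 0)) + Real.log (Fintype.card (α 1))) * ε := by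
  have h1 := entropy_le_two_outputs (c.jointLaw μ) (fun z => z.1 0) (fun z => z.1 1)
    (fun z => z.2 i) (fun z => z.2 j) (fun z => z.2 w) entropy_jointLaw_pair
    (h.2.2.entropy_single w) (h.2.1.entropy_pair hiw) (h.2.1.entropy_pair hjw)
    (h.2.1.entropy_triple hU)
  have h2 := h.1.entropy_le (μ := μ) hn i
  have h3 := h.1.entropy_le (μ := μ) hn j
  rw [entropy_jointLaw_source_apply, entropy_jointLaw_source_apply] at h1
  have hn' : (0 : ℝ) < n := by exact_mod_cast hn
  refine le_of_mul_le_mul_left ?_ hn'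
  field_simp
  linarith

end SMDCCode

/-- Let n → ∞ and then ε → 0; this needs `C` and `D` to be independent of both. -/
lemma le_of_forall_eventually_le {A B : ℝ} (C D : ℝ)
    (h : ∀ ε : ℝ, 0 < ε → ∀ᶠ n : ℕ in atTop, A ≤ B + C * (1 / (n : ℝ)) + D * ε) : A ≤ B := by
  have h1 : ∀ ε : ℝ, 0 < ε → A ≤ B + D * ε := by
    intro ε hε
    have ht : Tendsto (fun n : ℕ => B + C * (1 / (n : ℝ)) + D * ε) atTop
        (nhds (B + C * 0 + D * ε)) :=
      ((tendsto_one_div_atTop_nhds_zero_nat.const_mul C).const_add B).add_const _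
    simpa using ge_of_tendsto ht (h ε hε)
  have ht : Tendsto (fun ε : ℝ => B + D * ε) (nhdsWithin 0 (Set.Ioi 0)) (nhds (B + D * 0)) :=
    ((continuous_const.add (continuous_const.mul continuous_id)).tendsto 0).mono_left
      nhdsWithin_le_nhds
  simpa using ge_of_tendsto ht (eventually_mem_nhdsWithin.mono fun ε hε => h1 ε hε)

section

variable {α : Fin 2 → Type u} [∀ k, Fintype (α k)] [∀ k, MeasurableSpace (α k)]
  [∀ k, MeasurableSingletonClass (α k)] {μ : ∀ k, Measure (α k)}
  [∀ k, IsProbabilityMeasure (μ k)] {R : Fin 3 → ℝ}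

lemma sourceEntropy_le_of_mem_smdcRegion (hR : R ∈ smdcRegion 3 1 μ) {i w : Fin 3} (hiw : i ≠ w) :
    sourceEntropy (μ 0) ≤ R i := by
  refine le_of_forall_eventually_le (Real.log 2) (1 + Real.log (Fintype.card (α 0)))
    fun ε hε => ?_
  filter_upwards [hR.2 ε hε, eventually_gt_atTop 0] with n ⟨c, hc⟩ hn using
    hc.single_bound hn hiw

lemma sourceEntropy_le_add_of_mem_smdcRegion (hR : R ∈ smdcRegion 3 1 μ) {i j w : Fin 3}
    (hiw : i ≠ w) (hjw : j ≠ w) (hU : ({i, j, w} : Finset (Fin 3)) = Finset.univ) :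
    2 * sourceEntropy (μ 0) + sourceEntropy (μ 1) ≤ R i + R j := by
  refine le_of_forall_eventually_le (3 * Real.log 2)
    (2 + 3 * Real.log (Fintype.card (α 0)) + Real.log (Fintype.card (α 1))) fun ε hε => ?_
  filter_upwards [hR.2 ε hε, eventually_gt_atTop 0] with n ⟨c, hc⟩ hn using
    hc.pair_bound hn hiw hjw hU

end

lemma entropy_equiv {Ω β γ : Type*} [MeasurableSpace Ω] [Fintype β] [Fintype γ] (μ : Measure Ω)
    (X : Ω → β) (e : β ≃ γ) : entropy μ (fun ω => e (X ω)) = entropy μ X := by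
  refine (Fintype.sum_equiv e _ _ fun b => ?_).symm
  congr 2
  ext ω
  simp

/-! ### Laws of single-level codes -/

namespace SSDCCode

variable {L m n : ℕ} {α : Type u} [MeasurableSpace α]

instance isProbabilityMeasure_law (c : SSDCCode L m n α) (μ : Measure α)
    [IsProbabilityMeasure μ] : IsProbabilityMeasure (c.law μ) := by
  unfold law
  infer_instance

lemma measurable_output (c : SSDCCode L m n α) (A : Finset (Fin L)) : Measurable (c.output A) :=
  measurable_pi_lambda _ fun l => c.measurable_enc l

/-- An encoder cannot map a nonempty space into `Fin 0`. This lets the logarithm of a product of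
message counts split into a sum. -/
lemma M_ne_zero (c : SSDCCode L m n α) [Nonempty α] (l : Fin L) : c.M l ≠ 0 := by
  have : Nonempty c.Key := c.keyLaw.nonempty_of_neZero
  intro h
  exact (finCongr h (c.enc l (Classical.arbitrary _))).elim0

/-- Once the source block is fixed, the output depends on the key alone, so the event is a rectangle
in the product of source and key space. -/
lemma map_source_law [Fintype α] [MeasurableSingletonClass α] (c : SSDCCode L m n α)
    (μ : Measure α) [IsProbabilityMeasure μ] {β : Type*} [Fintype β] [MeasurableSpace β]
    [MeasurableSingletonClass β] (f : (Fin n → α) × c.Key → β) (hf : Measurable f)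
    (s : Fin n → α) (x : β) :
    (c.law μ).map (fun ω => (ω.1, f ω)) {(s, x)} =
      (Measure.pi fun _ : Fin n => μ) {s} * c.keyLaw {κ | f (s, κ) = x} := by
  rw [Measure.map_apply (measurable_fst.prodMk hf) (measurableSet_singleton _), law,
    ← Measure.prod_prod]
  congr 1
  ext ⟨s', κ⟩
  simp only [Set.mem_preimage, Set.mem_singleton_iff, Prod.mk.injEq, Set.mem_prod,
    Set.mem_ofPred_eq]
  exact ⟨fun h => ⟨h.1, h.1 ▸ h.2⟩, fun h => ⟨h.1, h.1.symm ▸ h.2⟩⟩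

lemma entropy_source [Fintype α] (c : SSDCCode L m n α) (μ : Measure α)
    [MeasurableSingletonClass α] [IsProbabilityMeasure μ] :
    entropy (c.law μ) Prod.fst = entropy (Measure.pi fun _ : Fin n => μ) (fun s => s) := by
  rw [← entropy_map (c.law μ) measurable_fst fun s => s, law, Measure.map_fst_prod, measure_univ,
    one_smul]

end SSDCCode

/-! ### Superposition of single-level codes -/

section Superposition

variable {L N n J : ℕ} {α : Fin J → Type u} [∀ k, MeasurableSpace (α k)]
  {c : ∀ k : Fin J, SSDCCode L (N + (k : ℕ) + 1) n (α k)} {r : Fin J → Fin L → ℝ} {ε : ℝ}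

lemma RateConstraint.superpose [∀ k, Nonempty (α k)] (h : ∀ k, (c k).RateConstraint (r k) ε) :
    (superpose c).RateConstraint (fun l => ∑ k, r k l) (J * ε) := by
  intro l
  change 1 / (n : ℝ) * Real.log ((∏ k, (c k).M l : ℕ) : ℝ) ≤ ∑ k, r k l + J * ε
  rw [Nat.cast_prod, Real.log_prod fun k _ => Nat.cast_ne_zero.2 ((c k).M_ne_zero l),
    Finset.mul_sum]
  refine (Finset.sum_le_sum fun k _ => h k l).trans_eq ?_
  simp [Finset.sum_add_distrib]

/-- The source block and the key that the code with index `k` uses in a superposition code. -/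
def component (c : ∀ k : Fin J, SSDCCode L (N + (k : ℕ) + 1) n (α k)) (k : Fin J)
    (ω : (∀ k, Fin n → α k) × (superpose c).Key) : (Fin n → α k) × (c k).Key :=
  (ω.1 k, ω.2 k)

lemma measurePreserving_component (c : ∀ k : Fin J, SSDCCode L (N + (k : ℕ) + 1) n (α k))
    (μ : ∀ k, Measure (α k)) [∀ k, IsProbabilityMeasure (μ k)] (k : Fin J) :
    MeasurePreserving (component c k) ((superpose c).law μ) ((c k).law (μ k)) :=
  (measurePreserving_eval (fun k => Measure.pi fun _ : Fin n => μ k) k).prod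
    (measurePreserving_eval (fun k => (c k).keyLaw) k)

lemma measurable_source_output (c : ∀ k : Fin J, SSDCCode L (N + (k : ℕ) + 1) n (α k))
    (A : Finset (Fin L)) : Measurable fun (ω : (∀ k, Fin n → α k) × (superpose c).Key) k =>
      (ω.1 k, (c k).output A (component c k ω)) :=
  measurable_pi_lambda _ fun k => (measurable_fst.prodMk ((c k).measurable_output A)).comp
    (((measurable_pi_apply k).comp measurable_fst).prodMk
      (show Measurable fun ω : (∀ k, Fin n → α k) × (∀ k, (c k).Key) => ω.2 k from
        (measurable_pi_apply k).comp measurable_snd))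

variable [∀ k, Fintype (α k)] [∀ k, MeasurableSingletonClass (α k)] {μ : ∀ k, Measure (α k)}
  [∀ k, IsProbabilityMeasure (μ k)]

/-- Union bound over the at most J sources that `U` has to decode. -/
lemma Reconstruction.superpose (hε : 0 ≤ ε) (h : ∀ k, (c k).Reconstruction (μ k) ε) :
    (superpose c).Reconstruction μ (J * ε) := by
  classical
  intro U hU
  set E : ∀ k : {k : Fin J // N + (k : ℕ) + 1 ≤ U.card}, Set ((Fin n → α k) × (c k).Key) :=
    fun k => {ω | (c k).dec U k.2 ((c k).output U ω) ≠ ω.1} with hE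
  have hmeas : ∀ k, MeasurableSet (E k) := by
    intro k
    exact (measurable_fst.prodMk ((c k).measurable_output U))
      (Set.toFinite {z : (Fin n → α k) × (∀ l : U, Fin ((c k).M l)) |
        (c k).dec U k.2 z.2 ≠ z.1}).measurableSet
  have hsub : {ω | (SecureDiversityCoding.superpose c).dec U hU
        ((SecureDiversityCoding.superpose c).output U ω) ≠
        fun k : {k : Fin J // N + (k : ℕ) + 1 ≤ U.card} => ω.1 k} ⊆
      ⋃ k : {k : Fin J // N + (k : ℕ) + 1 ≤ U.card},
        component c k ⁻¹' E k := by
    intro ω hω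
    obtain ⟨k, hk⟩ := Function.ne_iff.1 hω
    refine Set.mem_iUnion.2 ⟨k, ?_⟩
    simp only [SecureDiversityCoding.superpose, SMDCCode.output, Equiv.symm_apply_apply] at hk
    exact hk
  refine (measureReal_mono hsub).trans ((measureReal_iUnion_fintype_le _).trans ?_)
  calc _ ≤ ∑ k : {k : Fin J // N + (k : ℕ) + 1 ≤ U.card}, ε := by
        refine Finset.sum_le_sum fun k _ => ?_
        rw [(measurePreserving_component c μ k).measureReal_preimage
          (hmeas k).nullMeasurableSet]
        exact h k U k.2
    _ ≤ J * ε := by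
        rw [Finset.sum_const, nsmul_eq_mul, Finset.card_univ]
        gcongr
        exact (Fintype.card_subtype_le _).trans_eq (Fintype.card_fin J)

/-- The pairs of source block and coded messages are independent over `k`, since both the sources
and the keys are. On a finite space it is enough to compare singletons. -/
lemma map_superpose_law (c : ∀ k : Fin J, SSDCCode L (N + (k : ℕ) + 1) n (α k))
    (μ : ∀ k, Measure (α k)) [∀ k, IsProbabilityMeasure (μ k)] (A : Finset (Fin L)) :
    ((superpose c).law μ).map (fun ω k =>
      (ω.1 k, (c k).output A (component c k ω))) =
      Measure.pi fun k => ((c k).law (μ k)).map fun ω => (ω.1, (c k).output A ω) := by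
  have hm : ∀ k, IsProbabilityMeasure (((c k).law (μ k)).map fun ω => (ω.1, (c k).output A ω)) :=
    fun k => Measure.isProbabilityMeasure_map
      (measurable_fst.prodMk ((c k).measurable_output A)).aemeasurable
  refine Measure.ext_of_singleton fun z => ?_
  rw [Measure.pi_singleton, Finset.prod_congr rfl fun k _ =>
    (c k).map_source_law (μ k) ((c k).output A) ((c k).measurable_output A) (z k).1 (z k).2,
    Finset.prod_mul_distrib, ← Measure.pi_singleton (fun k => Measure.pi fun _ : Fin n => μ k)
      fun k => (z k).1, ← Measure.pi_pi]
  rw [Measure.map_apply (measurable_source_output c A) (measurableSet_singleton _)]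
  refine Eq.trans (congrArg _ ?_) (Measure.prod_prod _ _)
  ext ⟨s, κ⟩
  constructor
  · intro h
    have hk : ∀ k, (s k, (c k).output A (s k, κ k)) = z k := congrFun h
    exact ⟨funext fun k => congrArg Prod.fst (hk k), fun k _ => by
      simp only [Set.mem_ofPred_eq, ← hk k]⟩
  · rintro ⟨rfl, h⟩
    exact funext fun k => Prod.ext rfl (h k trivial)

/-- The outputs of the superposed encoders, sorted by sources. -/
def outputEquiv (c : ∀ k : Fin J, SSDCCode L (N + (k : ℕ) + 1) n (α k)) (A : Finset (Fin L)) :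
    (∀ k, ∀ l : A, Fin ((c k).M l)) ≃ (∀ l : A, Fin (∏ k, (c k).M l)) :=
  (Equiv.piComm _).trans (Equiv.piCongrRight fun _ => finPiFinEquiv)

/-- Regrouping of a family of pairs into a pair of families. -/
def pairEquiv {ι : Type*} (β γ : ι → Type*) : (∀ k, β k × γ k) ≃ (∀ k, β k) × (∀ k, γ k) where
  toFun z := (fun k => (z k).1, fun k => (z k).2)
  invFun z k := (z.1 k, z.2 k)

/-- By independence, H(S, X_A), H(X_A) and H(S) are sums over the sources, so the secrecy identities
of the components add up. Packing the messages of an encoder into one number is a bijection and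
leaves entropies unchanged. -/
lemma PerfectSecrecy.superpose (h : ∀ k, (c k).PerfectSecrecy N (μ k)) :
    (superpose c).PerfectSecrecy μ := by
  intro A hA
  set V : (∀ k, Fin n → α k) × (SecureDiversityCoding.superpose c).Key →
      ∀ k, (Fin n → α k) × (∀ l : A, Fin ((c k).M l)) :=
    fun ω k => (ω.1 k, (c k).output A (component c k ω)) with hV
  have hVm : Measurable V := measurable_source_output c A
  have hm : ∀ k, IsProbabilityMeasure (((c k).law (μ k)).map fun ω => (ω.1, (c k).output A ω)) :=
    fun k => Measure.isProbabilityMeasure_map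
      (measurable_fst.prodMk ((c k).measurable_output A)).aemeasurable
  have hout : (SecureDiversityCoding.superpose c).output A =
      fun ω => outputEquiv c A (fun k => (V ω k).2) := rfl
  have hmap := map_superpose_law c μ A
  rw [condEntropy_eq (Y := (SecureDiversityCoding.superpose c).output A) _ measurable_fst
    (measurable_pi_lambda _ fun l => (SecureDiversityCoding.superpose c).measurable_enc l)]
  have h1 : entropy ((SecureDiversityCoding.superpose c).law μ)
      (fun ω => (ω.1, (SecureDiversityCoding.superpose c).output A ω)) =
      ∑ k, entropy ((c k).law (μ k)) fun ω => (ω.1, (c k).output A ω) := by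
    rw [hout]
    have e := entropy_equiv ((SecureDiversityCoding.superpose c).law μ) V
      ((pairEquiv _ _).trans (Equiv.prodCongr (Equiv.refl _) (outputEquiv c A)))
    refine e.trans ?_
    refine (entropy_map _ hVm fun z => z).symm.trans ?_
    rw [hmap, entropy_pi]
    refine Finset.sum_congr rfl fun k _ => ?_
    rw [entropy_map _ (measurable_fst.prodMk ((c k).measurable_output A))]
  have h2 : entropy ((SecureDiversityCoding.superpose c).law μ)
      ((SecureDiversityCoding.superpose c).output A) =
      ∑ k, entropy ((c k).law (μ k)) ((c k).output A) := by
    rw [hout]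
    refine (entropy_equiv _ (fun ω k => (V ω k).2) (outputEquiv c A)).trans ?_
    refine (entropy_map _ hVm fun z k => (z k).2).symm.trans ?_
    rw [hmap]
    rw [← entropy_map (Measure.pi fun k => ((c k).law (μ k)).map fun ω => (ω.1, (c k).output A ω))
      (T := fun z k => (z k).2) (by fun_prop) fun z => z,
      Measure.pi_map_pi (f := fun k (z : (Fin n → α k) × (∀ l : A, Fin ((c k).M l))) => z.2)
        fun k => measurable_snd.aemeasurable]
    have hm' : ∀ k, IsProbabilityMeasure ((((c k).law (μ k)).map fun ω =>
        (ω.1, (c k).output A ω)).map Prod.snd) :=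
      fun k => Measure.isProbabilityMeasure_map measurable_snd.aemeasurable
    rw [entropy_pi]
    refine Finset.sum_congr rfl fun k _ => ?_
    rw [entropy_map _ measurable_snd,
      entropy_map _ (measurable_fst.prodMk ((c k).measurable_output A))]
  have h3 : entropy ((SecureDiversityCoding.superpose c).law μ) Prod.fst =
      ∑ k, entropy ((c k).law (μ k)) Prod.fst := by
    rw [← entropy_map ((SecureDiversityCoding.superpose c).law μ) measurable_fst fun s => s,
      SMDCCode.law, Measure.map_fst_prod, measure_univ, one_smul, entropy_pi]
    exact Finset.sum_congr rfl fun k _ => ((c k).entropy_source (μ k)).symm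
  rw [h1, h2, h3, ← Finset.sum_sub_distrib]
  refine Finset.sum_congr rfl fun k _ => ?_
  rw [← h k A hA, condEntropy_eq _ measurable_fst ((c k).measurable_output A)]

end Superposition

lemma superpositionRateRegion_subset {L N J : ℕ} {α : Fin J → Type u} [∀ k, Fintype (α k)]
    [∀ k, MeasurableSpace (α k)] [∀ k, MeasurableSingletonClass (α k)] (μ : ∀ k, Measure (α k))
    [∀ k, IsProbabilityMeasure (μ k)] :
    superpositionRateRegion L N μ ⊆ superpositionAchievable L N μ := by
  rintro R ⟨r, hr, hR⟩
  obtain rfl : R = fun l => ∑ k, r k l := funext hR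
  refine ⟨fun l => Finset.sum_nonneg fun k _ => (hr k).1 l, fun ε hε => ?_⟩
  -- J components lose J times the tolerance; J + 1 instead of J also covers J = 0.
  have hε' : 0 < ε / (J + 1) := by positivity
  have hle : J * (ε / (J + 1)) ≤ ε := by
    rw [mul_div_assoc', div_le_iff₀ (by positivity)]
    nlinarith
  filter_upwards [eventually_all.2 fun k => (hr k).2 _ hε'] with n hn
  choose c hc using hn
  refine ⟨c, fun l => ?_, fun U hU => ?_, PerfectSecrecy.superpose fun k => (hc k).2.2⟩
  · have hne : ∀ k, Nonempty (α k) := fun k => (μ k).nonempty_of_neZero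
    have := RateConstraint.superpose (fun k => (hc k).1) l
    linarith
  · exact (Reconstruction.superpose hε'.le (fun k => (hc k).2.1) U hU).trans hle

lemma superpositionAchievable_subset {L N J : ℕ} {α : Fin J → Type u} [∀ k, Fintype (α k)]
    [∀ k, MeasurableSpace (α k)] (μ : ∀ k, Measure (α k)) :
    superpositionAchievable L N μ ⊆ smdcRegion L N μ :=
  fun _ hR => ⟨hR.1, fun ε hε => (hR.2 ε hε).mono fun _ ⟨c, hc⟩ => ⟨superpose c, hc⟩⟩

/-! ### Typical source blocks -/

section Typical

variable {α : Type u} [MeasurableSpace α]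

lemma sourceEntropy_nonneg [Fintype α] (μ : Measure α) [IsProbabilityMeasure μ] : 0 ≤ sourceEntropy μ :=
  Finset.sum_nonneg fun _ _ => Real.negMulLog_nonneg measureReal_nonneg measureReal_le_one

lemma real_block_singleton (μ : Measure α) [IsProbabilityMeasure μ] {n : ℕ} (s : Fin n → α) :
    (Measure.pi fun _ : Fin n => μ).real {s} = ∏ i, μ.real {s i} := by
  simp [Measure.real, Measure.pi_singleton, ENNReal.toReal_prod]

variable [Fintype α] [MeasurableSingletonClass α]

lemma sourceEntropy_eq_integral (μ : Measure α) [IsProbabilityMeasure μ] :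
    sourceEntropy μ = ∫ a, -Real.log (μ.real {a}) ∂μ := by
  rw [integral_fintype .of_finite, sourceEntropy, entropy_eq_sum]
  rfl

/-- Chebyshev's inequality for the self-information of a source block. -/
lemma real_atypical_le (μ : Measure α) [IsProbabilityMeasure μ] {n : ℕ} (hn : 0 < n) {δ : ℝ}
    (hδ : 0 < δ) :
    (Measure.pi fun _ : Fin n => μ).real
      {s | n * δ ≤ |∑ i, -Real.log (μ.real {s i}) - n * sourceEntropy μ|} ≤
      ProbabilityTheory.variance (fun a => -Real.log (μ.real {a})) μ / δ ^ 2 * (1 / (n : ℝ)) := by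
  set f : α → ℝ := fun a => -Real.log (μ.real {a}) with hf
  have hn' : (0 : ℝ) < n := by exact_mod_cast hn
  have hmem : MemLp (∑ i : Fin n, fun s : Fin n → α => f (s i)) 2
      (Measure.pi fun _ : Fin n => μ) := .of_discrete
  have hmean : ∫ s, (∑ i : Fin n, fun s : Fin n → α => f (s i)) s
      ∂(Measure.pi fun _ : Fin n => μ) = n * sourceEntropy μ := by
    simp only [Finset.sum_apply]
    rw [integral_finsetSum _ fun i _ => .of_finite, sourceEntropy_eq_integral]
    have : ∀ i : Fin n, ∫ s : Fin n → α, f (s i) ∂(Measure.pi fun _ : Fin n => μ) =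
        ∫ a, f a ∂μ := fun i =>
      integral_comp_eval (μ := fun _ : Fin n => μ) (f := f)
        (Integrable.of_finite).aestronglyMeasurable
    rw [Finset.sum_congr rfl fun i _ => this i]
    simp [hf]
  have hvar : ProbabilityTheory.variance (∑ i : Fin n, fun s : Fin n → α => f (s i))
      (Measure.pi fun _ : Fin n => μ) = n * ProbabilityTheory.variance f μ := by
    rw [ProbabilityTheory.variance_sum_pi (X := fun _ => f) fun i => .of_discrete]
    simp
  have h := ProbabilityTheory.meas_ge_le_variance_div_sq hmem (c := n * δ) (by positivity)
  rw [hmean, hvar] at h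
  simp only [Finset.sum_apply] at h
  have hV : 0 ≤ ProbabilityTheory.variance f μ := ProbabilityTheory.variance_nonneg _ _
  refine (ENNReal.toReal_le_of_le_ofReal (by positivity) h).trans_eq ?_
  field_simp

/-- Asymptotic equipartition: few source blocks carry almost all probability. -/
lemma eventually_exists_typical (μ : Measure α) [IsProbabilityMeasure μ] {δ ε : ℝ} (hδ : 0 < δ)
    (hε : 0 < ε) : ∀ᶠ n : ℕ in atTop, ∃ T : Finset (Fin n → α),
      (T.card : ℝ) ≤ Real.exp (n * (sourceEntropy μ + δ)) ∧
      (Measure.pi fun _ : Fin n => μ).real {s | s ∉ T} ≤ ε := by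
  classical
  have hlim := (tendsto_one_div_atTop_nhds_zero_nat (𝕜 := ℝ)).const_mul
    (ProbabilityTheory.variance (fun a => -Real.log (μ.real {a})) μ / δ ^ 2)
  rw [mul_zero] at hlim
  filter_upwards [hlim.eventually_le_const hε, eventually_gt_atTop 0] with n hnε hn
  set P := Measure.pi fun _ : Fin n => μ with hP
  set b := n * (sourceEntropy μ + δ) with hb
  -- Blocks of probability at least e^(-b): there are at most e^b of them because probabilities add
  -- up to 1.
  refine ⟨Finset.univ.filter fun s => Real.exp (-b) ≤ P.real {s}, ?_, ?_⟩
  · have h1 : ((Finset.univ.filter fun s => Real.exp (-b) ≤ P.real {s}).card : ℝ) *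
        Real.exp (-b) ≤ 1 := by
      rw [← sum_real_singleton P, ← nsmul_eq_mul]
      exact (Finset.card_nsmul_le_sum _ _ _ fun s hs => (Finset.mem_filter.1 hs).2).trans
        (Finset.sum_le_sum_of_subset_of_nonneg (Finset.subset_univ _)
          fun _ _ _ => measureReal_nonneg)
    have h2 := mul_le_mul_of_nonneg_right h1 (Real.exp_pos b).le
    rwa [mul_assoc, ← Real.exp_add, neg_add_cancel, Real.exp_zero, mul_one, one_mul] at h2
  -- Blocks of probability zero need their own argument: since `Real.log 0 = 0`, the sum of
  -- self-informations says nothing about them.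
  · have hnull : P.real {s | P.real {s} = 0} = 0 := by
      have h2 : ((Finset.univ.filter fun s => P.real {s} = 0 : Finset (Fin n → α)) :
          Set (Fin n → α)) = {s | P.real {s} = 0} := by ext; simp
      rw [← h2, ← sum_measureReal_singleton]
      exact Finset.sum_eq_zero fun s hs => (Finset.mem_filter.1 hs).2
    have hsub : {s | s ∉ Finset.univ.filter fun s => Real.exp (-b) ≤ P.real {s}} ⊆
        {s | P.real {s} = 0} ∪
          {s | n * δ ≤ |∑ i, -Real.log (μ.real {s i}) - n * sourceEntropy μ|} := by
      intro s hs
      simp only [Finset.mem_filter, Finset.mem_univ, true_and, not_le, Set.mem_ofPred_eq] at hs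
      by_cases h0 : P.real {s} = 0
      · exact Or.inl h0
      refine Or.inr ?_
      have h3 : Real.log (P.real {s}) < -b :=
        (Real.log_lt_iff_lt_exp (lt_of_le_of_ne measureReal_nonneg (Ne.symm h0))).2 hs
      rw [hP, real_block_singleton] at h0 h3
      rw [Real.log_prod fun i hi => Finset.prod_ne_zero_iff.1 h0 i hi] at h3
      rw [Set.mem_ofPred_eq]
      refine le_trans ?_ (le_abs_self _)
      rw [Finset.sum_neg_distrib]
      linarith
    refine (measureReal_mono hsub).trans ((measureReal_union_le _ _).trans ?_)
    rw [hnull, zero_add]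
    exact (real_atypical_le μ hn hδ).trans hnε

end Typical

/-! ### Diversity codes from secret sharing schemes -/

/-- A scheme that splits a secret, with the help of a uniformly distributed key, into `L` shares
such that any `m` shares determine the secret and any `N` shares are independent of it. -/
structure SharingScheme (L N m : ℕ) (σ K V : Type) where
  share : Fin L → σ → K → V
  recover : ∀ U : Finset (Fin L), m ≤ U.card → ∀ s κ s' κ',
    (∀ l ∈ U, share l s κ = share l s' κ') → s = s'
  secret : ∀ A : Finset (Fin L), A.card ≤ N → ∀ s s', ∃ π : Equiv.Perm K, ∀ l ∈ A, ∀ κ,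
    share l s κ = share l s' (π κ)

/-- A uniform key is invariant under permutations. This turns the permutation in
`SharingScheme.secret` into equality of the laws of the shares of two secrets. -/
lemma uniformOn_univ_preimage_equiv {K : Type*} [Fintype K] [MeasurableSpace K]
    [DiscreteMeasurableSpace K] (π : Equiv.Perm K) (E : Set K) :
    ProbabilityTheory.uniformOn Set.univ (π ⁻¹' E) = ProbabilityTheory.uniformOn Set.univ E := by
  rw [ProbabilityTheory.uniformOn_univ, ProbabilityTheory.uniformOn_univ,
    Measure.count_apply .of_discrete, Measure.count_apply .of_discrete,
    Set.encard_preimage_of_bijective π.bijective]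

namespace SharingScheme

variable {L N m : ℕ} {σ K V : Type} [Fintype σ] [Fintype K] [DecidableEq V]

/-- The values that the share with index `l` can take. -/
def values (S : SharingScheme L N m σ K V) (l : Fin L) : Finset V :=
  Finset.univ.image fun p : σ × K => S.share l p.1 p.2

lemma share_mem_values (S : SharingScheme L N m σ K V) (l : Fin L) (s : σ) (κ : K) :
    S.share l s κ ∈ S.values l :=
  Finset.mem_image.2 ⟨(s, κ), Finset.mem_univ _, rfl⟩

lemma card_values_le (S : SharingScheme L N m σ K V) (l : Fin L) {F : Finset V}
    (h : ∀ s κ, S.share l s κ ∈ F) : (S.values l).card ≤ F.card := by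
  refine Finset.card_le_card fun v hv => ?_
  obtain ⟨p, -, rfl⟩ := Finset.mem_image.1 hv
  exact h _ _

/-- The share with index `l`, numbered. -/
noncomputable def numbered (S : SharingScheme L N m σ K V) (l : Fin L) (s : σ) (κ : K) :
    Fin (S.values l).card :=
  (S.values l).equivFin ⟨S.share l s κ, S.share_mem_values l s κ⟩

lemma numbered_eq_iff (S : SharingScheme L N m σ K V) (l : Fin L) (s s' : σ) (κ κ' : K) :
    S.numbered l s κ = S.numbered l s' κ' ↔ S.share l s κ = S.share l s' κ' := by
  simp [numbered]

variable [Nonempty σ] [Nonempty K] {α : Type u} [MeasurableSpace α] [Fintype α]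
  [MeasurableSingletonClass α] {n : ℕ}

/-- The diversity code that compresses a source block to a secret and shares the secret. -/
noncomputable def toCode (S : SharingScheme L N m σ K V) (f : (Fin n → α) → σ)
    (g : σ → Fin n → α) : SSDCCode L m n α :=
  letI : MeasurableSpace K := ⊤
  -- Only attained values are counted, so shares with the common type `V` may have different rates.
  { M := fun l => (S.values l).card
    Key := K
    keyLaw := ProbabilityTheory.uniformOn Set.univ
    keyProb := ProbabilityTheory.isProbabilityMeasure_uniformOn Set.finite_univ Set.univ_nonempty
    enc := fun l ω => S.numbered l (f ω.1) ω.2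
    measurable_enc := fun _ => measurable_of_finite _
    -- Any secret consistent with the shares will do; `recover` makes it unique.
    dec := fun U _ x => g (Classical.epsilon fun s => ∃ κ, ∀ l : U, S.numbered l s κ = x l) }

/-- The shares give back the secret without error, so decoding fails only for blocks outside `T`. -/
lemma toCode_reconstruction (S : SharingScheme L N m σ K V) {f : (Fin n → α) → σ}
    {g : σ → Fin n → α} {T : Finset (Fin n → α)} (hfg : ∀ s ∈ T, g (f s) = s) {μ : Measure α}
    [IsProbabilityMeasure μ] {ε : ℝ}
    (hT : (Measure.pi fun _ : Fin n => μ).real {s | s ∉ T} ≤ ε) :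
    (S.toCode f g).Reconstruction μ ε := by
  intro U hU
  refine le_trans (measureReal_mono (s₂ := {s | s ∉ T} ×ˢ Set.univ) ?_) ?_
  · rintro ⟨s, κ⟩ hs
    refine ⟨fun hsT => hs ?_, trivial⟩
    change g (Classical.epsilon fun s' => ∃ κ', ∀ l : U, S.numbered l s' κ' =
      S.numbered l (f s) κ) = s
    obtain ⟨κ', h⟩ := Classical.epsilon_spec (p := fun s' => ∃ κ', ∀ l : U, S.numbered l s' κ' =
      S.numbered l (f s) κ) ⟨f s, κ, fun _ => rfl⟩
    rw [S.recover U hU _ κ' (f s) κ fun l hl => (S.numbered_eq_iff l _ _ _ _).1 (h ⟨l, hl⟩)]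
    exact hfg s hsT
  · rw [SSDCCode.law, measureReal_prod_prod]
    simpa using hT

/-- Given the source block, the law of the observed shares is that for a fixed reference block `s₀`.
The joint law is therefore a product and its entropy the sum of the marginal entropies. -/
lemma toCode_perfectSecrecy (S : SharingScheme L N m σ K V) (f : (Fin n → α) → σ)
    (g : σ → Fin n → α) (μ : Measure α) [IsProbabilityMeasure μ] :
    (S.toCode f g).PerfectSecrecy N μ := by
  intro A hA
  set c := S.toCode f g with hc
  set P := Measure.pi fun _ : Fin n => μ with hP
  obtain ⟨s₀⟩ : Nonempty (Fin n → α) := P.nonempty_of_neZero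
  set w : (∀ l : A, Fin (c.M l)) → ℝ := fun x => c.keyLaw.real {κ | c.output A (s₀, κ) = x} with hw
  have hkey : ∀ s x, c.keyLaw.real {κ | c.output A (s, κ) = x} = w x := by
    intro s x
    obtain ⟨π, hπ⟩ := S.secret A hA (f s) (f s₀)
    have hout : ∀ κ : K, c.output A (s, κ) = c.output A (s₀, π κ) := fun κ => by
      funext l
      exact (S.numbered_eq_iff l _ _ _ _).2 (hπ l l.2 κ)
    have hpre : {κ | c.output A (s, κ) = x} = π ⁻¹' {κ | c.output A (s₀, κ) = x} := by
      ext κ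
      exact ⟨fun h => (hout κ).symm.trans h, fun h => (hout κ).trans h⟩
    let _ : MeasurableSpace K := ⊤
    change (ProbabilityTheory.uniformOn (Set.univ : Set K)).real _ = _
    rw [hpre, Measure.real, uniformOn_univ_preimage_equiv]
    rfl
  have hm : Measurable fun ω => (ω.1, c.output A ω) := measurable_fst.prodMk (c.measurable_output A)
  have hprob : IsProbabilityMeasure ((c.law μ).map fun ω => (ω.1, c.output A ω)) :=
    Measure.isProbabilityMeasure_map hm.aemeasurable
  have hjoint : ∀ s x, ((c.law μ).map fun ω => (ω.1, c.output A ω)).real {(s, x)} =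
      P.real {s} * w x := by
    intro s x
    rw [Measure.real, c.map_source_law μ _ (c.measurable_output A), ENNReal.toReal_mul, ← hkey s x]
    rfl
  have hmarg : ∀ x, (c.law μ).real (c.output A ⁻¹' {x}) = w x := by
    intro x
    have h := sum_real_preimage_prod ((c.law μ).map fun ω => (ω.1, c.output A ω)) Prod.fst Prod.snd x
    rw [map_measureReal_apply hm (Set.toFinite _).measurableSet] at h
    refine Eq.trans h.symm ?_
    have h1 : ∀ s, (fun z : (Fin n → α) × (∀ l : A, Fin (c.M l)) => (z.1, z.2)) ⁻¹' {(s, x)} =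
      {(s, x)} := fun s => rfl
    simp only [h1, hjoint]
    rw [← Finset.sum_mul, sum_real_singleton, one_mul]
  have hw1 : ∑ x, w x = 1 := by
    have h := sum_real_preimage ((c.law μ).map fun ω => (ω.1, c.output A ω)) Prod.snd
    refine Eq.trans (Finset.sum_congr rfl fun x _ => ?_) h
    rw [map_measureReal_apply hm (Set.toFinite _).measurableSet, ← hmarg]
    rfl
  rw [condEntropy_eq _ measurable_fst (c.measurable_output A), c.entropy_source,
    ← entropy_map _ hm fun z => z]
  have h2 : ∀ z : (Fin n → α) × (∀ l : A, Fin (c.M l)),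
      (fun z : (Fin n → α) × (∀ l : A, Fin (c.M l)) => z) ⁻¹' {z} = {(z.1, z.2)} := fun z => rfl
  have h3 : ∀ s : Fin n → α, (fun s : Fin n → α => s) ⁻¹' {s} = {s} := fun s => rfl
  simp only [entropy, h2, hjoint, hmarg, h3, Real.negMulLog_mul]
  rw [Fintype.sum_prod_type]
  simp only [Finset.sum_add_distrib, ← Finset.sum_mul, ← Finset.mul_sum, hw1]
  rw [sum_real_singleton P]
  ring

end SharingScheme

/-- Secret sharing schemes with a large enough secret space give admissible rates. -/
lemma mem_ssdcRegion_of_schemes {L N m : ℕ} {α : Type u} [Fintype α] [MeasurableSpace α]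
    [MeasurableSingletonClass α] (μ : Measure α) [IsProbabilityMeasure μ] {R : Fin L → ℝ}
    (hR : ∀ l, 0 ≤ R l)
    (h : ∀ ε : ℝ, 0 < ε → ∃ δ : ℝ, 0 < δ ∧ ∀ᶠ n : ℕ in atTop, ∃ (σ K V : Type) (_ : Fintype σ)
      (_ : Fintype K) (_ : Nonempty σ) (_ : Nonempty K) (_ : DecidableEq V)
      (S : SharingScheme L N m σ K V),
      Real.exp (n * (sourceEntropy μ + δ)) ≤ Fintype.card σ ∧
      ∀ l, Real.log (S.values l).card ≤ n * (R l + ε)) : R ∈ ssdcRegion L N m μ := by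
  refine ⟨hR, fun ε hε => ?_⟩
  obtain ⟨δ, hδ, hn⟩ := h ε hε
  filter_upwards [hn, eventually_exists_typical μ hδ hε, eventually_gt_atTop 0] with
    n ⟨σ, K, V, _, _, _, _, _, S, hσ, hS⟩ ⟨T, hT, hT'⟩ hn
  have hcard : T.card ≤ Fintype.card σ := by exact_mod_cast hT.trans hσ
  obtain ⟨f, -, hf⟩ := T.finite_toSet.exists_injOn_of_encard_le (t := (Set.univ : Set σ)) (by
    rw [Set.encard_coe_eq_coe_finsetCard, Set.encard_univ, ENat.card_eq_coe_fintype_card]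
    exact_mod_cast hcard)
  have : Nonempty (Fin n → α) := (Measure.pi fun _ : Fin n => μ).nonempty_of_neZero
  refine ⟨S.toCode f (Function.invFunOn f T), fun l => ?_, S.toCode_reconstruction
    (fun s hs => hf.leftInvOn_invFunOn hs) hT', S.toCode_perfectSecrecy f _ μ⟩
  have hn' : (0 : ℝ) < n := by exact_mod_cast hn
  rw [one_div, inv_mul_le_iff₀ hn']
  exact hS l

/-! ### Two explicit sharing schemes -/

/-- Shamir's scheme in odd characteristic: any two of the shares `κ + l s`, `l = 0, 1, 2`, determine
the secret `s`. -/
def twoOutOfThree (q : ℕ) : SharingScheme 3 1 2 (ZMod (2 * q + 1)) (ZMod (2 * q + 1))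
    (ZMod (2 * q + 1)) where
  share l s κ := κ + (l : ℕ) * s
  recover U hU s κ s' κ' h := by
    -- Shares 0 and 2 differ by 2s, so 2 has to be cancelled; its inverse modulo 2q + 1 is -q.
    have h2 : ∀ a b : ZMod (2 * q + 1), 2 * a = 2 * b → a = b := by
      intro a b hab
      have h0 : (2 : ZMod (2 * q + 1)) * q + 1 = 0 := by
        have := ZMod.natCast_self (2 * q + 1)
        push_cast at this
        exact this
      linear_combination (-(q : ZMod (2 * q + 1))) * hab + (a - b) * h0
    obtain ⟨i, hi, j, hj, hij⟩ := Finset.one_lt_card.1 hU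
    have hi' := h i hi
    have hj' := h j hj
    fin_cases i <;> fin_cases j <;> simp at hij hi' hj' <;> first
      | linear_combination hi' - hj'
      | linear_combination hj' - hi'
      | (apply h2; linear_combination hi' - hj')
      | (apply h2; linear_combination hj' - hi')
  secret A hA s s' := by
    obtain ⟨l, hl⟩ := Finset.card_le_one_iff_subset_singleton.1 hA
    refine ⟨Equiv.addRight ((l : ℕ) * s - (l : ℕ) * s'), fun l' hl' κ => ?_⟩
    obtain rfl := Finset.mem_singleton.1 (hl hl')
    simp only [Equiv.coe_addRight]
    ring

/-- A scheme in which all three shares determine the secret `(s₁, s₂, s₃)`, while the share with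
index `i` only consists of a key for the component of the other shares that lies in `ZMod a`. -/
def threeOutOfThree (a b : ℕ) (i : Fin 3) : SharingScheme 3 1 3 (ZMod a × ZMod a × ZMod b)
    (ZMod a × ZMod b) (ZMod a × ZMod b) where
  share l s κ :=
    -- The mask `κ.1` is used twice and both masks are sent in the clear once; this is safe because
    -- no more than one share is observed. Indices are added modulo 3.
    if l = i then (κ.1, 0) else if l = i + 1 then (κ.1 + s.1, κ.2) else
      (κ.1 + s.2.1, κ.2 + s.2.2)
  recover U hU s κ s' κ' h := by
    have hU' : U = Finset.univ := Finset.eq_univ_of_card U (le_antisymm (Finset.card_le_univ U) hU)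
    subst hU'
    have h0 := h i (Finset.mem_univ _)
    have h1 := h (i + 1) (Finset.mem_univ _)
    have h2 := h (i + 2) (Finset.mem_univ _)
    simp only [add_eq_left, add_right_inj, Fin.reduceEq, if_true, if_false, Prod.mk.injEq]
      at h0 h1 h2
    refine Prod.ext ?_ (Prod.ext ?_ ?_)
    · linear_combination h1.1 - h0.1
    · linear_combination h2.1 - h0.1
    · linear_combination h2.2 - h1.2
  secret A hA s s' := by
    obtain ⟨l, hl⟩ := Finset.card_le_one_iff_subset_singleton.1 hA
    refine ⟨Equiv.addRight (if l = i then 0 else if l = i + 1 then (s.1 - s'.1, 0) else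
      (s.2.1 - s'.2.1, s.2.2 - s'.2.2)), fun l' hl' κ => ?_⟩
    obtain rfl := Finset.mem_singleton.1 (hl hl')
    split_ifs <;> simp [add_assoc]

lemma twoOutOfThree_card_values_le (q : ℕ) (l : Fin 3) :
    ((twoOutOfThree q).values l).card ≤ 2 * q + 1 := by
  refine (Finset.card_le_univ _).trans_eq ?_
  rw [ZMod.card]

lemma threeOutOfThree_card_values_self_le (a b : ℕ) [NeZero a] [NeZero b] (i : Fin 3) :
    ((threeOutOfThree a b i).values i).card ≤ a := by
  refine ((threeOutOfThree a b i).card_values_le i (F := Finset.univ ×ˢ {0})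
    fun s κ => ?_).trans_eq ?_
  · simp [threeOutOfThree]
  · simp [ZMod.card]

lemma threeOutOfThree_card_values_le (a b : ℕ) [NeZero a] [NeZero b] (i l : Fin 3) :
    ((threeOutOfThree a b i).values l).card ≤ a * b := by
  refine (Finset.card_le_univ _).trans_eq ?_
  rw [Fintype.card_prod, ZMod.card, ZMod.card]

lemma log_natCeil_exp_le {x : ℝ} (hx : 0 ≤ x) :
    Real.log (⌈Real.exp x⌉₊ : ℝ) ≤ x + Real.log 2 := by
  have h1 : (1 : ℝ) ≤ Real.exp x := Real.one_le_exp hx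
  have h2 : (⌈Real.exp x⌉₊ : ℝ) ≤ Real.exp x * 2 := by
    linarith [Nat.ceil_lt_add_one (Real.exp_pos x).le]
  refine (Real.log_le_log (by exact_mod_cast Nat.ceil_pos.2 (Real.exp_pos x)) h2).trans_eq ?_
  rw [Real.log_mul (Real.exp_pos x).ne' two_ne_zero, Real.log_exp]

lemma eventually_le_nat_mul (C : ℝ) {δ : ℝ} (hδ : 0 < δ) : ∀ᶠ n : ℕ in atTop, C ≤ n * δ :=
  (tendsto_natCast_atTop_atTop.atTop_mul_const hδ).eventually_ge_atTop C

/-! ### Admissible rates of the single-level problems -/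

section Achievability

variable {α : Type u} [Fintype α] [MeasurableSpace α] [MeasurableSingletonClass α]
  (μ : Measure α) [IsProbabilityMeasure μ] {R : Fin 3 → ℝ}

lemma mem_ssdcRegion_two (hR : ∀ l, sourceEntropy μ ≤ R l) : R ∈ ssdcRegion 3 1 2 μ := by
  have hH := sourceEntropy_nonneg μ
  refine mem_ssdcRegion_of_schemes μ (fun l => hH.trans (hR l)) fun ε hε => ⟨ε / 2, by linarith, ?_⟩
  -- Half of ε enlarges the secret space beyond the typical set. The other half pays for rounding up
  -- (log 2) and for the odd modulus 2q + 1 ≤ 3q (log 3).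
  filter_upwards [eventually_le_nat_mul (Real.log 2 + Real.log 3) (half_pos hε)] with n hn
  set y := n * (sourceEntropy μ + ε / 2) with hy
  have hy0 : 0 ≤ y := by positivity
  set q := ⌈Real.exp y⌉₊ with hq
  have hq0 : 0 < q := Nat.ceil_pos.2 (Real.exp_pos y)
  refine ⟨ZMod (2 * q + 1), ZMod (2 * q + 1), ZMod (2 * q + 1), inferInstance, inferInstance,
    inferInstance, inferInstance, inferInstance, twoOutOfThree q, ?_, fun l => ?_⟩
  · rw [ZMod.card]
    refine (Nat.le_ceil _).trans ?_
    exact_mod_cast (by omega : q ≤ 2 * q + 1)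
  · have h1 : (((twoOutOfThree q).values l).card : ℝ) ≤ 3 * q := by
      exact_mod_cast (twoOutOfThree_card_values_le q l).trans (by omega : 2 * q + 1 ≤ 3 * q)
    have h0 : 0 < ((twoOutOfThree q).values l).card :=
      Finset.card_pos.2 ⟨_, (twoOutOfThree q).share_mem_values l 0 0⟩
    have h2 := Real.log_le_log (by exact_mod_cast h0) h1
    rw [Real.log_mul three_ne_zero (by positivity)] at h2
    have h3 := log_natCeil_exp_le hy0
    have h4 := mul_le_mul_of_nonneg_left (hR l) (Nat.cast_nonneg (α := ℝ) n)
    simp only [hy] at h3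
    linarith

/-- The encoder `i` of smallest rate gets the short share, of rate x = min(R_i, H/2). With a ≈
e^(nx) and b ≈ e^(n(H - 2x)), the secret space has a²b ≈ e^(nH) elements and the long shares have
rate H - x. The cap H/2 keeps the exponent of b nonnegative. The long shares fit: H - R_i ≤ R_l by
the pair condition, and if x = H/2 then R_l ≥ R_i ≥ H/2. -/
lemma mem_ssdcRegion_three (h0 : ∀ l, 0 ≤ R l)
    (hR : ∀ i j, i ≠ j → sourceEntropy μ ≤ R i + R j) : R ∈ ssdcRegion 3 1 3 μ := by
  have hH := sourceEntropy_nonneg μ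
  obtain ⟨i, hi⟩ := Finite.exists_min R
  set x := min (R i) (sourceEntropy μ / 2) with hx
  have hx0 : 0 ≤ x := le_min (h0 i) (by linarith)
  have hx1 : x ≤ R i := min_le_left _ _
  have hx2 : x ≤ sourceEntropy μ / 2 := min_le_right _ _
  have hx3 : ∀ l, l ≠ i → sourceEntropy μ - x ≤ R l := by
    intro l hl
    have h1 := hi l
    have h2 := hR l i hl
    rcases min_choice (R i) (sourceEntropy μ / 2) with h | h <;> rw [hx, h] <;> linarith
  -- A long share exceeds its rate by ε/3 from each of `a` and `b`; the last third absorbs the two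
  -- roundings.
  refine mem_ssdcRegion_of_schemes μ h0 fun ε hε => ⟨ε / 3, by linarith, ?_⟩
  filter_upwards [eventually_le_nat_mul (2 * Real.log 2) (δ := ε / 3) (by linarith)] with n hn
  set y := n * (x + ε / 3) with hy
  set z := n * (sourceEntropy μ - 2 * x + ε / 3) with hz
  have hy0 : 0 ≤ y := by positivity
  have hz0 : 0 ≤ z := mul_nonneg (Nat.cast_nonneg n) (by linarith)
  set a := ⌈Real.exp y⌉₊ with ha
  set b := ⌈Real.exp z⌉₊ with hb
  have ha0 : 0 < a := Nat.ceil_pos.2 (Real.exp_pos y)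
  have hb0 : 0 < b := Nat.ceil_pos.2 (Real.exp_pos z)
  have : NeZero a := ⟨ha0.ne'⟩
  have : NeZero b := ⟨hb0.ne'⟩
  refine ⟨ZMod a × ZMod a × ZMod b, ZMod a × ZMod b, ZMod a × ZMod b, inferInstance, inferInstance,
    inferInstance, inferInstance, inferInstance, threeOutOfThree a b i, ?_, fun l => ?_⟩
  · rw [Fintype.card_prod, Fintype.card_prod, ZMod.card, ZMod.card]
    push_cast
    calc Real.exp (n * (sourceEntropy μ + ε / 3)) ≤ Real.exp (y + (y + z)) := by
          refine Real.exp_le_exp.2 ?_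
          have : 0 ≤ n * (2 * (ε / 3)) := by positivity
          rw [hy, hz]
          linarith
      _ = Real.exp y * (Real.exp y * Real.exp z) := by rw [Real.exp_add, Real.exp_add]
      _ ≤ a * (a * b) := by
          gcongr <;> exact Nat.le_ceil _
  · have hpos : (0 : ℝ) < ((threeOutOfThree a b i).values l).card := by
      exact_mod_cast Finset.card_pos.2 ⟨_, (threeOutOfThree a b i).share_mem_values l 0 0⟩
    have hlog2 : 0 ≤ Real.log 2 := Real.log_nonneg one_le_two
    have h3 := log_natCeil_exp_le hy0
    have h4 := log_natCeil_exp_le hz0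
    simp only [hy] at h3
    simp only [hz] at h4
    have hn0 : (0 : ℝ) ≤ n := Nat.cast_nonneg n
    have hnε : 0 ≤ n * (ε / 3) := by positivity
    by_cases hl : l = i
    · subst hl
      have h1 : (((threeOutOfThree a b l).values l).card : ℝ) ≤ a := by
        exact_mod_cast threeOutOfThree_card_values_self_le a b l
      have h2 := Real.log_le_log hpos h1
      have h5 := mul_le_mul_of_nonneg_left hx1 hn0
      linarith
    · have h1 : (((threeOutOfThree a b i).values l).card : ℝ) ≤ a * b := by
        exact_mod_cast threeOutOfThree_card_values_le a b i l
      have h2 := Real.log_le_log hpos h1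
      rw [Real.log_mul (by positivity) (by positivity)] at h2
      have h5 := mul_le_mul_of_nonneg_left (hx3 l hl) hn0
      linarith

end Achievability

/-! ### Rate splitting and the theorem -/

lemma mem_superpositionRateRegion {α : Fin 2 → Type u} [∀ k, Fintype (α k)]
    [∀ k, MeasurableSpace (α k)] [∀ k, MeasurableSingletonClass (α k)] (μ : ∀ k, Measure (α k))
    [∀ k, IsProbabilityMeasure (μ k)] {R : Fin 3 → ℝ} (h1 : ∀ l, sourceEntropy (μ 0) ≤ R l)
    (h2 : ∀ i j, i ≠ j → 2 * sourceEntropy (μ 0) + sourceEntropy (μ 1) ≤ R i + R j) :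
    R ∈ superpositionRateRegion 3 1 μ := by
  refine ⟨![fun _ => sourceEntropy (μ 0), fun l => R l - sourceEntropy (μ 0)], ?_, fun l => ?_⟩
  · rw [Fin.forall_fin_two]
    refine ⟨mem_ssdcRegion_two (μ 0) fun _ => le_rfl, mem_ssdcRegion_three (μ 1)
      (fun l => sub_nonneg.2 (h1 l)) fun i j hij => ?_⟩
    have := h2 i j hij
    change _ ≤ R i - _ + (R j - _)
    linarith
  · rw [Fin.sum_univ_two]
    simp

end SecureDiversityCoding

/-- For the `(3, 1)` secure symmetrical multilevel diversity coding problem with two independent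
discrete memoryless sources, the admissible rate region is given by the six inequalities below, and
superposition coding achieves all of it. -/
theorem theorem3 {α : Fin 2 → Type u} [∀ k, Fintype (α k)] [∀ k, MeasurableSpace (α k)]
    [∀ k, MeasurableSingletonClass (α k)] (μ : ∀ k, Measure (α k))
    [∀ k, IsProbabilityMeasure (μ k)] :
    SecureDiversityCoding.smdcRegion 3 1 μ =
        {R : Fin 3 → ℝ |
          SecureDiversityCoding.sourceEntropy (μ 0) ≤ R 0 ∧
          SecureDiversityCoding.sourceEntropy (μ 0) ≤ R 1 ∧
          SecureDiversityCoding.sourceEntropy (μ 0) ≤ R 2 ∧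
          2 * SecureDiversityCoding.sourceEntropy (μ 0) +
              SecureDiversityCoding.sourceEntropy (μ 1) ≤ R 0 + R 1 ∧
          2 * SecureDiversityCoding.sourceEntropy (μ 0) +
              SecureDiversityCoding.sourceEntropy (μ 1) ≤ R 1 + R 2 ∧
          2 * SecureDiversityCoding.sourceEntropy (μ 0) +
              SecureDiversityCoding.sourceEntropy (μ 1) ≤ R 2 + R 0} ∧
      SecureDiversityCoding.superpositionAchievable 3 1 μ =
        SecureDiversityCoding.smdcRegion 3 1 μ ∧
      SecureDiversityCoding.superpositionRateRegion 3 1 μ =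
        SecureDiversityCoding.smdcRegion 3 1 μ := by
  have hconv : SecureDiversityCoding.smdcRegion 3 1 μ ⊆
      SecureDiversityCoding.superpositionRateRegion 3 1 μ := fun R hR => by
    refine SecureDiversityCoding.mem_superpositionRateRegion μ (fun l => ?_) fun i j hij => ?_
    · exact SecureDiversityCoding.sourceEntropy_le_of_mem_smdcRegion hR (w := l + 1) (by simp)
    · obtain ⟨w, hiw, hjw, hU⟩ : ∃ w, i ≠ w ∧ j ≠ w ∧
          ({i, j, w} : Finset (Fin 3)) = Finset.univ := by
        revert i j
        decide
      exact SecureDiversityCoding.sourceEntropy_le_add_of_mem_smdcRegion hR hiw hjw hU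
  have hsup := SecureDiversityCoding.superpositionRateRegion_subset (L := 3) (N := 1) μ
  have hach := SecureDiversityCoding.superpositionAchievable_subset (L := 3) (N := 1) μ
  refine ⟨Set.Subset.antisymm (fun R hR => ?_) ?_, hach.antisymm (hconv.trans hsup),
    (hsup.trans hach).antisymm hconv⟩
  · exact ⟨SecureDiversityCoding.sourceEntropy_le_of_mem_smdcRegion hR (w := 1) (by decide),
      SecureDiversityCoding.sourceEntropy_le_of_mem_smdcRegion hR (w := 0) (by decide),
      SecureDiversityCoding.sourceEntropy_le_of_mem_smdcRegion hR (w := 0) (by decide),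
      SecureDiversityCoding.sourceEntropy_le_add_of_mem_smdcRegion hR (w := 2) (by decide)
        (by decide) (by decide),
      SecureDiversityCoding.sourceEntropy_le_add_of_mem_smdcRegion hR (w := 0) (by decide)
        (by decide) (by decide),
      SecureDiversityCoding.sourceEntropy_le_add_of_mem_smdcRegion hR (w := 1) (by decide)
        (by decide) (by decide)⟩
  · rintro R ⟨h0, h1, h2, h01, h12, h20⟩
    refine hach (hsup (SecureDiversityCoding.mem_superpositionRateRegion μ (fun l => ?_)
      fun i j hij => ?_))
    · fin_cases l
      exacts [h0, h1, h2]
    · fin_cases i <;> fin_cases j <;> simp at hij ⊢ <;> linarith
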